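/- Theorem 3.3. For $n,k\ge 1$ let $\Pi_0$ be the set of matrices in $\{0,1\}^{n\times k}$ with exactly one nonzero entry in each row, and let $\Pi_1$ be the set of matrices in $[0,1]^{n\times k}$ all of whose rows sum to $1$. For $Z\in\Pi_0$ let $n_a(Z)=|\{i:Z_{i,a}=1\}|$ be the size of community $a\in[k]$, and let $$\Pi_0^{(\rho,\rho')}=\{Z\in\Pi_0:\ \rho n/k\le n_a(Z)\le\rho' n/k\ \text{ for all } a\in[k]\}.$$ In the stochastic block model with assignment $Z^*\in\Pi_0$ and connection probabilities $0\le q<p\le 1$, the network on $[n]$ is undirected without self-loops, and its edges $\{i,j\}$, $i<j$, are independent Bernoulli variables with parameters $P_{i,j}=(Z^*BZ^{*T})_{i,j}$, where $B=q1_k1_k^T+(p-q)I_k$; that is, $P_{i,j}=p$ if $i,j$ are in the same community and $P_{i,j}=q$ otherwise. Let $$\ell(Z,Z')=\inf_{\phi}\sum_{i,a}|Z_{i,a}-Z'_{i,\phi(a)}|,$$ with the infimum over all bijections $\phi$ of $[k]$, and let $I=-2\log\big[\sqrt{pq}+\sqrt{(1-p)(1-q)}\big]$. All of $k=k_n$,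 $p=p_n$, $q=q_n$, $\rho=\rho_n$, $\rho'=\rho'_n$ (hence $I=I_n$) may depend on $n$. Assume that $0\le q<p\le1$ for all $n$, that $$\frac{nI}{k\log k}\to\infty\qquad(n\to\infty),$$ and that, for all large $n$, $\ \rho n/k+1\le n/k\le\rho' n/k-1$. (a) Suppose that $k\ge3$ for all large $n$, that $\rho n/k\to\infty$ and $\rho nI/(k\log(k/\rho))\to\infty$, and that $\rho n/k$ is asymptotically attained as the size of the two smallest communities: for every $\varepsilon>0$ and all large $n$ there are $Z\in\Pi_0^{(\rho,\rho')}$ and $a\ne b$ with $(n_a(Z)+n_b(Z))/2\le(1+\varepsilon)\rho n/k$. Then there is a real sequence $\eta=\eta_n\to0$ such that, for all large $n$, $$\inf_{\hat\pi}\ \sup_{Z^*\in\Pi_0^{(\rho,\rho')}}\mathbb E\,\ell(\hat\pi,Z^*)\ \ge\ n\exp\big(-(1-\eta)\rho nI/k\big).$$ (b) Suppose that $k=2$ for all large $n$. Then there is a real sequence $\eta=\eta_n\to0$ such that, for all large $n$, $$\inf_{\hat\pi}\ \sup_{Z^*\in\Pi_0^{(\rho,\rho')}}\mathbb E\,\ell(\hat\pi,Z^*)\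 \ge\ n\exp\big(-(1-\eta)nI/2\big).$$ In both parts the infimum is over all estimators $\hat\pi$, that is, over all functions from networks on $[n]$ to $\Pi_1$; the function may depend on $n,k,p,q,\rho,\rho'$. -/

import Mathlib

open Filter Topology

namespace SBM

/-- Rényi divergence of order `1/2` between `Ber(p)` and `Ber(q)`. -/
noncomputable def renyiHalf (p q : ℝ) : ℝ :=
  -2 * Real.log (Real.sqrt (p * q) + Real.sqrt ((1 - p) * (1 - q)))

/-- `Π₀`: matrices in `{0,1}^{n×k}` each of whose rows has exactly one nonzero entry. -/
def Pi0 (n k : ℕ) : Set (Matrix (Fin n) (Fin k) ℝ) :=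
  {π | (∀ i a, π i a = 0 ∨ π i a = 1) ∧ ∀ i, {a | π i a ≠ 0}.ncard = 1}

/-- `Π₁`: matrices in `[0,1]^{n×k}` each of whose rows has `ℓ₁` norm one. -/
def Pi1 (n k : ℕ) : Set (Matrix (Fin n) (Fin k) ℝ) :=
  {π | (∀ i a, 0 ≤ π i a ∧ π i a ≤ 1) ∧ ∀ i, ∑ a, |π i a| = 1}

/-- The number of nodes that `π` puts in community `a`. -/
noncomputable def communitySize {n k : ℕ} (π : Matrix (Fin n) (Fin k) ℝ) (a : Fin k) : ℕ :=
  {i | π i a = 1}.ncard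

/-- `Π₀^{(ρ,ρ')}`: assignments all of whose community sizes lie in `[ρ n / k, ρ' n / k]`. -/
def Pi0Sized (n k : ℕ) (ρ ρ' : ℝ) : Set (Matrix (Fin n) (Fin k) ℝ) :=
  {π | π ∈ Pi0 n k ∧ ∀ a, ρ * n / k ≤ communitySize π a ∧ (communitySize π a : ℝ) ≤ ρ' * n / k}

/-- The `ℓ₁` loss up to relabelling of the communities. -/
noncomputable def loss {n k : ℕ} (Z Z' : Matrix (Fin n) (Fin k) ℝ) : ℝ :=
  ⨅ φ : Equiv.Perm (Fin k), ∑ i, ∑ a, |Z i a - Z' i (φ a)|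

/-- The connectivity matrix `B = q 1 1ᵀ + (p - q) I`. -/
def connectivity (k : ℕ) (p q : ℝ) : Matrix (Fin k) (Fin k) ℝ :=
  Matrix.of fun a b => if a = b then p else q

/-- `P = Z B Zᵀ`; only its off-diagonal entries are used. -/
def edgeProb {n k : ℕ} (p q : ℝ) (Z : Matrix (Fin n) (Fin k) ℝ) : Matrix (Fin n) (Fin n) ℝ :=
  Z * connectivity k p q * Z.transpose

open Classical in
/-- The probability that the stochastic block model with assignment `Z` produces the network `G`:
the edges `{i, j}`, `i < j`, are independent Bernoulli variables with parameters `P i j`. -/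
noncomputable def sbmProb {n k : ℕ} (p q : ℝ) (Z : Matrix (Fin n) (Fin k) ℝ)
    (G : SimpleGraph (Fin n)) : ℝ :=
  ∏ i : Fin n, ∏ j ∈ Finset.Ioi i,
    if G.Adj i j then edgeProb p q Z i j else 1 - edgeProb p q Z i j

open Classical in
/-- `E ℓ(π̂, Z)` when the observed network has the law `sbmProb p q Z`. -/
noncomputable def expectedLoss {n k : ℕ} (p q : ℝ)
    (πhat : SimpleGraph (Fin n) → Pi1 n k) (Z : Matrix (Fin n) (Fin k) ℝ) : ℝ :=
  ∑ G : SimpleGraph (Fin n), sbmProb p q Z G * loss (πhat G : Matrix (Fin n) (Fin k) ℝ) Z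

/-- The minimax risk: the infimum over all estimators, i.e. all maps from networks to `Π₁`, of the
largest expected loss over `Π₀^{(ρ,ρ')}`. The supremum is over a finite set and the infimum is of
nonnegative numbers, so both are genuine as soon as `Π₀^{(ρ,ρ')}` is nonempty. -/
noncomputable def minimaxRisk (n k : ℕ) (p q ρ ρ' : ℝ) : ℝ :=
  ⨅ πhat : SimpleGraph (Fin n) → Pi1 n k, ⨆ Z : Pi0Sized n k ρ ρ',
    expectedLoss p q πhat (Z : Matrix (Fin n) (Fin k) ℝ)

end SBM

namespace SBM

/-! Labelling one node is a two-point testing problem. Take communities a, b of size about ℓ (ρn/k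
in (a), n/2 in (b)) between which a node can be moved. The move changes at most about ℓ edge
probabilities from p to q and at most about ℓ from q to p, and the two error probabilities of any
test between the resulting laws P, P' add up to at least ∑ min(P, P'). Where both are positive,
min(P, P') = √(PP') exp(-|L|/2) with L the log-likelihood ratio. If m edges change each way, √(PP')
has total mass exp(-mI), and under its normalisation L is centred with variance of order m(I + I²)
(`llr_variance_le`). Hence the overlap is at least exp(-(mI + c)) with c of order √(m(I + I²)),
which is o(mI) as m and mI tend to infinity (`overlap_lower`). Neither I nor the ratio p/q need be
bounded.

To charge many nodes at once, let T consist of 2t+1 nodes of a and b, t about ℓ/5, and take the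
uniform prior on labellings of T by a and b in which t or t+1 nodes get a. Only two size profiles
occur, one node apart, so one unit of room in the constraints suffices. Pairing a set S of a-nodes
with S ∪ {i} bounds the risk below by (t+1) times the overlap (`bayes_lower`). The infimum over
relabellings does no harm: the known labels outside T settle which columns stand for a and b
(`exists_perm_sum_rowLoss_le`).

The prefactor is thus of order ℓ rather than n, but log(n/ℓ) = o(ℓI) under the hypotheses, so the
factor n/ℓ is absorbed into the exponent. -/

/-! ### A single pair of Bernoulli laws: affinity and variance of the log-likelihood ratio -/

lemma log_ratio_sq_le {x y : ℝ} (hx : 0 < x) (hy : 0 < y) :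
    x * y * (Real.log (x / y)) ^ 2 ≤ (x - y) ^ 2 := by
  wlog h : y ≤ x generalizing x y
  · have := this hy hx (le_of_not_ge h)
    rw [← inv_div, Real.log_inv]
    nlinarith [this]
  have hθ : 0 ≤ Real.log (x / y) := Real.log_nonneg ((one_le_div hy).2 h)
  set θ := Real.log (x / y) with hθd
  -- This is the inequality between geometric and logarithmic mean, with (x - y)² / (xy) = 4
  -- sinh²(θ/2).
  have h1 : θ / 2 ≤ Real.sinh (θ / 2) := Real.self_le_sinh_iff.2 (by positivity)
  rw [Real.sinh_eq] at h1
  have h2 : θ ^ 2 ≤ (Real.exp (θ / 2) - Real.exp (-(θ / 2))) ^ 2 := by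
    apply pow_le_pow_left₀ hθ; linarith
  have h3 : (Real.exp (θ / 2) - Real.exp (-(θ / 2))) ^ 2 = x / y + y / x - 2 := by
    have e1 : Real.exp (θ / 2) ^ 2 = x / y := by
      rw [← Real.exp_nat_mul, ← Real.exp_log (div_pos hx hy)]; congr 1; push_cast; ring
    have e2 : Real.exp (-(θ / 2)) ^ 2 = y / x := by
      rw [Real.exp_neg, inv_pow, e1, inv_div]
    have e3 : Real.exp (θ / 2) * Real.exp (-(θ / 2)) = 1 := by
      rw [← Real.exp_add]; simp
    rw [sub_sq, e1, e2, mul_assoc, e3]; ring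
  calc x * y * θ ^ 2 ≤ x * y * (x / y + y / x - 2) := by
        apply mul_le_mul_of_nonneg_left (h2.trans h3.le); positivity
    _ = (x - y) ^ 2 := by field_simp; ring

/-- The Hellinger affinity of `Ber(p)` and `Ber(q)`. -/
noncomputable def hellingerAffinity (p q : ℝ) : ℝ :=
  Real.sqrt (p * q) + Real.sqrt ((1 - p) * (1 - q))

lemma hellingerAffinity_eq_exp {p q : ℝ} (hz : 0 < hellingerAffinity p q) :
    hellingerAffinity p q = Real.exp (-(renyiHalf p q / 2)) := by
  have : -(renyiHalf p q / 2) = Real.log (hellingerAffinity p q) := by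
    unfold renyiHalf hellingerAffinity; ring
  rw [this, Real.exp_log hz]

lemma hellingerAffinity_sq {p q : ℝ} (hp0 : 0 ≤ p) (hp1 : p ≤ 1) (hq0 : 0 ≤ q) (hq1 : q ≤ 1) :
    hellingerAffinity p q ^ 2 =
      1 - (Real.sqrt (p * (1 - q)) - Real.sqrt (q * (1 - p))) ^ 2 := by
  have a1 : 0 ≤ 1 - p := by linarith
  have a2 : 0 ≤ 1 - q := by linarith
  have e : Real.sqrt (p * q) * Real.sqrt ((1 - p) * (1 - q)) =
      Real.sqrt (p * (1 - q)) * Real.sqrt (q * (1 - p)) := by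
    rw [← Real.sqrt_mul (by positivity), ← Real.sqrt_mul (by positivity)]; congr 1; ring
  unfold hellingerAffinity
  rw [add_sq, sub_sq, Real.sq_sqrt (by positivity), Real.sq_sqrt (by positivity),
    Real.sq_sqrt (by positivity), Real.sq_sqrt (by positivity), mul_assoc, e]
  ring

/-- Under the law proportional to √(Ber(p) Ber(q)), the left side divided by the squared affinity is
the variance of the log-likelihood ratio. With U = √(p(1-q)), W = √(q(1-p)) and θ = log(U/W) it
becomes 4UWθ², while the squared affinity is 1 - (U - W)² = exp(-I). The term linear in I governs
small I, the quadratic one large I. -/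
lemma llr_variance_le {p q : ℝ} (hq0 : 0 ≤ q) (hqp : q < p) (hp1 : p ≤ 1)
    (hz : 0 < hellingerAffinity p q) :
    Real.sqrt (p * q) * Real.sqrt ((1 - p) * (1 - q)) *
      (Real.log (p / q) - Real.log ((1 - p) / (1 - q))) ^ 2 ≤
    hellingerAffinity p q ^ 2 * (12 * renyiHalf p q + 32 * renyiHalf p q ^ 2) := by
  have hsq := hellingerAffinity_sq (hq0.trans hqp.le) hp1 hq0 (hqp.le.trans hp1)
  have hexp : hellingerAffinity p q ^ 2 = Real.exp (-renyiHalf p q) := by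
    rw [hellingerAffinity_eq_exp hz, ← Real.exp_nat_mul]; congr 1; push_cast; ring
  set I := renyiHalf p q with hI
  have hI0 : 0 ≤ I := by
    have : Real.exp (-I) ≤ 1 := by rw [← hexp, hsq]; nlinarith [sq_nonneg (√(p * (1 - q)) - √(q * (1 - p)))]
    rw [Real.exp_le_one_iff] at this; linarith
  have hR : 0 ≤ hellingerAffinity p q ^ 2 * (12 * I + 32 * I ^ 2) := by positivity
  -- For q = 0 or p = 1 a square root on the left vanishes, so the conventional values of the
  -- logarithms do not matter.
  rcases hq0.eq_or_lt with h0 | hq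
  · rw [← h0] at hR ⊢; simpa using hR
  rcases hp1.eq_or_lt with h1 | hp
  · rw [h1] at hR ⊢; simpa using hR
  have hp0 : 0 < p := hq.trans hqp
  have a1 : 0 < 1 - p := by linarith
  have a2 : 0 < 1 - q := by linarith
  have eU : Real.sqrt (p * q) * Real.sqrt ((1 - p) * (1 - q)) =
      Real.sqrt (p * (1 - q)) * Real.sqrt (q * (1 - p)) := by
    rw [← Real.sqrt_mul (by positivity), ← Real.sqrt_mul (by positivity)]; congr 1; ring
  have hU : 0 < Real.sqrt (p * (1 - q)) := Real.sqrt_pos.2 (by positivity)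
  have hW : 0 < Real.sqrt (q * (1 - p)) := Real.sqrt_pos.2 (by positivity)
  have hlog : Real.log (p / q) - Real.log ((1 - p) / (1 - q)) =
      2 * Real.log (Real.sqrt (p * (1 - q)) / Real.sqrt (q * (1 - p))) := by
    rw [Real.log_div hU.ne' hW.ne', Real.log_sqrt (by positivity), Real.log_sqrt (by positivity),
      Real.log_mul hp0.ne' a2.ne', Real.log_mul hq.ne' a1.ne', Real.log_div hp0.ne' hq.ne',
      Real.log_div a1.ne' a2.ne']
    ring
  have hU1 : Real.sqrt (p * (1 - q)) ≤ 1 := Real.sqrt_le_one.2 (by nlinarith)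
  have h2UW : 2 * (Real.sqrt (p * (1 - q)) * Real.sqrt (q * (1 - p))) ≤ Real.exp (-I) := by
    rw [← hexp, hsq]
    have e1 := Real.sq_sqrt (show 0 ≤ p * (1 - q) by positivity)
    have e2 := Real.sq_sqrt (show 0 ≤ q * (1 - p) by positivity)
    nlinarith [mul_pos hp0 hq, mul_pos a1 a2]
  have hWU : Real.sqrt (q * (1 - p)) ≤ Real.sqrt (p * (1 - q)) :=
    Real.sqrt_le_sqrt (by nlinarith)
  rw [hexp, eU, hlog]
  rw [hexp] at hsq
  clear_value I
  clear hexp hR eU hlog hI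
  have key := log_ratio_sq_le hU hW
  set U := Real.sqrt (p * (1 - q))
  set W := Real.sqrt (q * (1 - p))
  have hθ0 : 0 ≤ Real.log (U / W) := Real.log_nonneg ((one_le_div hW).2 hWU)
  have hWe : W = U * Real.exp (-Real.log (U / W)) := by
    rw [Real.exp_neg, Real.exp_log (div_pos hU hW)]; field_simp
  set θ := Real.log (U / W)
  have hmain : U * W * θ ^ 2 ≤ Real.exp (-I) * (3 * I + 8 * I ^ 2) := by
    -- For I ≤ 1, UWθ² ≤ (U - W)² = 1 - exp(-I) ≤ I ≤ 3I exp(-I). For I ≥ 1, either θ ≤ 2I and 2UW ≤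
    -- exp(-I) is enough, or UW ≤ exp(-θ) beats θ².
    rcases le_total I 1 with hI1 | hI1
    · have b1 : 1 - I ≤ Real.exp (-I) := by linarith [Real.add_one_le_exp (-I)]
      have b2 : 1 / 3 ≤ Real.exp (-I) := by
        have : Real.exp (-1) ≤ Real.exp (-I) := Real.exp_le_exp.2 (by linarith)
        have h3 : Real.exp 1 < 3 := Real.exp_one_lt_three
        rw [Real.exp_neg] at this
        have : (3:ℝ)⁻¹ ≤ (Real.exp 1)⁻¹ := inv_anti₀ (Real.exp_pos _) h3.le
        linarith
      nlinarith [sq_nonneg I, mul_nonneg hI0 (sub_nonneg.2 b2), mul_nonneg (sq_nonneg I) (Real.exp_pos (-I)).le]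
    · rcases le_total θ (2 * I) with h | h
      · have : θ ^ 2 ≤ (2 * I) ^ 2 := pow_le_pow_left₀ hθ0 h 2
        have h3 : U * W * θ ^ 2 ≤ (Real.exp (-I) / 2) * (2 * I) ^ 2 := by
          apply mul_le_mul _ this (by positivity) (by positivity); linarith
        nlinarith [mul_nonneg (sq_nonneg I) (Real.exp_pos (-I)).le, mul_nonneg hI0 (Real.exp_pos (-I)).le]
      · have h1 : U * W ≤ Real.exp (-θ) := by
          rw [hWe]
          have : U * U ≤ 1 := by nlinarith
          nlinarith [Real.exp_pos (-θ)]
        have h2 : Real.exp (-θ) ≤ Real.exp (-I) * Real.exp (-(θ / 2)) := by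
          rw [← Real.exp_add]; apply Real.exp_le_exp.2; linarith
        have h3 : θ ^ 2 * Real.exp (-(θ / 2)) ≤ 8 := by
          have := Real.quadratic_le_exp_of_nonneg (show 0 ≤ θ / 2 by positivity)
          rw [Real.exp_neg, ← div_eq_mul_inv, div_le_iff₀ (Real.exp_pos _)]
          nlinarith
        have h4 : U * W * θ ^ 2 ≤ Real.exp (-I) * 8 := by
          calc U * W * θ ^ 2 ≤ (Real.exp (-I) * Real.exp (-(θ / 2))) * θ ^ 2 := by
                apply mul_le_mul_of_nonneg_right (h1.trans h2); positivity
            _ = Real.exp (-I) * (θ ^ 2 * Real.exp (-(θ / 2))) := by ring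
            _ ≤ _ := mul_le_mul_of_nonneg_left h3 (Real.exp_pos _).le
        have h5 : Real.exp (-I) * 8 ≤ Real.exp (-I) * (3 * I + 8 * I ^ 2) := by
          apply mul_le_mul_of_nonneg_left _ (Real.exp_pos _).le; nlinarith
        linarith
  nlinarith [hmain]

/-- The probability mass function of `Ber(x)`. -/
def bern (x : ℝ) (b : Bool) : ℝ := if b then x else 1 - x

lemma bern_nonneg {x : ℝ} (h0 : 0 ≤ x) (h1 : x ≤ 1) (b : Bool) : 0 ≤ bern x b := by
  cases b <;> simp [bern] <;> linarith

lemma sum_bern (x : ℝ) : ∑ b, bern x b = 1 := by simp [bern]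

/-! ### Overlap of products of Bernoulli laws -/

section Product
variable {E : Type*} [Fintype E]

lemma sum_prod_fun [DecidableEq E] (w : E → Bool → ℝ) :
    ∑ ω : E → Bool, ∏ e, w e (ω e) = ∏ e, ∑ b, w e b := by
  rw [Finset.prod_univ_sum, Fintype.piFinset_univ]

/-- Variance of a sum of independent centred variables on a product of two-point spaces. -/
lemma sum_prod_mul_sq [DecidableEq E] (w g : E → Bool → ℝ) (hw : ∀ e, ∑ b, w e b = 1)
    (hg : ∀ e, ∑ b, w e b * g e b = 0) :
    ∑ ω : E → Bool, (∏ e, w e (ω e)) * (∑ e, g e (ω e)) ^ 2 =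
      ∑ e, ∑ b, w e b * g e b ^ 2 := by
  have key : ∀ e e', ∑ ω : E → Bool, (∏ d, w d (ω d)) * (g e (ω e) * g e' (ω e')) =
      if e = e' then ∑ b, w e b * g e b ^ 2 else 0 := by
    intro e e'
    have h1 : ∀ ω : E → Bool, (∏ d, w d (ω d)) * (g e (ω e) * g e' (ω e')) =
        ∏ d, (w d (ω d) * ((if d = e then g e (ω d) else 1) *
          (if d = e' then g e' (ω d) else 1))) := by
      intro ω
      rw [Finset.prod_mul_distrib, Finset.prod_mul_distrib]
      simp
    simp_rw [h1]
    rw [sum_prod_fun (fun d b => w d b * ((if d = e then g e b else 1) *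
          (if d = e' then g e' b else 1)))]
    split_ifs with h
    · subst h
      rw [Finset.prod_eq_single e]
      · simp [sq]
      · intro d _ hd
        simpa [hd] using hw d
      · simp
    · apply Finset.prod_eq_zero (Finset.mem_univ e)
      simpa [h] using hg e
  calc _ = ∑ ω : E → Bool, ∑ e, ∑ e', (∏ d, w d (ω d)) * (g e (ω e) * g e' (ω e')) := by
        refine Finset.sum_congr rfl fun ω _ => ?_
        rw [sq, Finset.sum_mul_sum, Finset.mul_sum]
        refine Finset.sum_congr rfl fun e _ => ?_
        rw [Finset.mul_sum]
    _ = ∑ e, ∑ e', ∑ ω : E → Bool, (∏ d, w d (ω d)) * (g e (ω e) * g e' (ω e')) := by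
        rw [Finset.sum_comm]
        refine Finset.sum_congr rfl fun e _ => ?_
        rw [Finset.sum_comm]
    _ = _ := by simp [key]

/-- The overlap `∑ min(P, P')` of two products of Bernoulli laws. -/
noncomputable def overlap [DecidableEq E] (u v : E → ℝ) : ℝ :=
  ∑ ω : E → Bool, min (∏ e, bern (u e) (ω e)) (∏ e, bern (v e) (ω e))

/-- Extra independent coordinates only make two laws easier to distinguish: a sum of minima is at
most the minimum of the marginal sums. This permits padding to a balanced situation. -/
lemma overlap_sum_le {F : Type*} [Fintype F] [DecidableEq E] [DecidableEq F]
    (u v : E → ℝ) (u' v' : F → ℝ) :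
    overlap (Sum.elim u u') (Sum.elim v v') ≤ overlap u v := by
  unfold overlap
  rw [← (Equiv.sumArrowEquivProdArrow E F Bool).symm.sum_comp, Fintype.sum_prod_type]
  refine Finset.sum_le_sum fun ω _ => ?_
  have hs : ∀ x : F → ℝ, ∑ w : F → Bool, ∏ e, bern (x e) (w e) = 1 := by
    intro x
    rw [sum_prod_fun (fun e b => bern (x e) b)]
    exact Finset.prod_eq_one fun e _ => sum_bern _
  refine le_min ?_ ?_
  · calc _ ≤ ∑ w : F → Bool, (∏ e, bern (u e) (ω e)) * ∏ e, bern (u' e) (w e) := by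
          refine Finset.sum_le_sum fun w _ => (min_le_left _ _).trans ?_
          simp [Fintype.prod_sum_type, Equiv.sumArrowEquivProdArrow]
      _ = _ := by rw [← Finset.mul_sum, hs, mul_one]
  · calc _ ≤ ∑ w : F → Bool, (∏ e, bern (v e) (ω e)) * ∏ e, bern (v' e) (w e) := by
          refine Finset.sum_le_sum fun w _ => (min_le_right _ _).trans ?_
          simp [Fintype.prod_sum_type, Equiv.sumArrowEquivProdArrow]
      _ = _ := by rw [← Finset.mul_sum, hs, mul_one]

/-- The minimum equals √(ab) exp(-|l|/2). Linearising the exponential at |l|/2 = c and bounding |l|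
by a quadratic leaves an expression in l² alone, so a second moment replaces any truncation or
central limit argument. -/
lemma le_min_of_llr {a b c l : ℝ} (ha : 0 ≤ a) (hb : 0 ≤ b) (hc : 0 < c)
    (hl : 0 < a → 0 < b → Real.log (a / b) = l) :
    Real.exp (-c) * (Real.sqrt (a * b) * (1 + c / 2) - Real.sqrt (a * b) * l ^ 2 / (8 * c))
      ≤ min a b := by
  rcases ha.eq_or_lt with h | ha
  · simp [← h, hb]
  rcases hb.eq_or_lt with h | hb
  · simp [← h, ha.le]
  have hl := hl ha hb
  rw [Real.log_div ha.ne' hb.ne'] at hl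
  have hs : Real.sqrt (a * b) = Real.exp ((Real.log a + Real.log b) / 2) := by
    rw [← Real.log_mul ha.ne' hb.ne', ← Real.log_sqrt (by positivity), Real.exp_log (by positivity)]
  have h1 : Real.sqrt (a * b) * Real.exp (-|l| / 2) ≤ min a b := by
    rw [hs, ← Real.exp_add]
    refine le_min ?_ ?_
    · calc _ ≤ Real.exp (Real.log a) := Real.exp_le_exp.2 (by linarith [neg_abs_le l])
        _ = a := Real.exp_log ha
    · calc _ ≤ Real.exp (Real.log b) := Real.exp_le_exp.2 (by linarith [le_abs_self l])
        _ = b := Real.exp_log hb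
  refine le_trans ?_ h1
  have h2 : Real.exp (-|l| / 2) ≥ Real.exp (-c) * (1 + c / 2 - l ^ 2 / (8 * c)) := by
    have h3 : Real.exp (-|l| / 2) = Real.exp (-c) * Real.exp (c - |l| / 2) := by
      rw [← Real.exp_add]; congr 1; ring
    rw [h3]
    apply mul_le_mul_of_nonneg_left _ (Real.exp_pos _).le
    have h4 := Real.add_one_le_exp (c - |l| / 2)
    have h5 : |l| / 2 ≤ c / 2 + l ^ 2 / (8 * c) := by
      rw [← sq_abs, div_add_div _ _ (by norm_num) (by positivity), div_le_div_iff₀ (by norm_num) (by positivity)]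
      nlinarith [sq_nonneg (|l| - 2 * c)]
    linarith
  have := mul_le_mul_of_nonneg_left h2 (Real.sqrt_nonneg (a * b))
  calc _ = Real.sqrt (a * b) * (Real.exp (-c) * (1 + c / 2 - l ^ 2 / (8 * c))) := by ring
    _ ≤ _ := this

/-- Overlap of two product laws in which equally many coordinates change from `p` to `q` as from
`q` to `p`, the sign `s` recording the direction. -/
lemma overlap_balanced [DecidableEq E] {p q : ℝ} (hq0 : 0 ≤ q) (hqp : q < p) (hp1 : p ≤ 1)
    (hz : 0 < hellingerAffinity p q) (u v s : E → ℝ)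
    (hs : ∀ e, (s e = 1 ∧ u e = p ∧ v e = q) ∨ (s e = -1 ∧ u e = q ∧ v e = p) ∨
      (s e = 0 ∧ u e = v e ∧ 0 ≤ u e ∧ u e ≤ 1))
    {m : ℝ} (hs0 : ∑ e, s e = 0) (hs2 : ∑ e, s e ^ 2 = 2 * m) {c : ℝ} (hc : 0 < c)
    (hmc : m * (6 * renyiHalf p q + 16 * renyiHalf p q ^ 2) ≤ c ^ 2) (hm : 0 ≤ m) :
    Real.exp (-(m * renyiHalf p q + c)) ≤ overlap u v := by
  have hu : ∀ e, 0 ≤ u e ∧ u e ≤ 1 := by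
    intro e; rcases hs e with h | h | h
    · rw [h.2.1]; exact ⟨by linarith, by linarith⟩
    · rw [h.2.1]; exact ⟨by linarith, by linarith⟩
    · exact h.2.2
  have hv : ∀ e, 0 ≤ v e ∧ v e ≤ 1 := by
    intro e; rcases hs e with h | h | h
    · rw [h.2.2]; exact ⟨by linarith, by linarith⟩
    · rw [h.2.2]; exact ⟨by linarith, by linarith⟩
    · rw [← h.2.1]; exact h.2.2
  set z := hellingerAffinity p q with hzd
  set I := renyiHalf p q with hI
  set h₁ := Real.sqrt (p * q) with hh₁
  set h₀ := Real.sqrt ((1 - p) * (1 - q)) with hh₀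
  have hz' : z = h₁ + h₀ := rfl
  set l₁ := Real.log (p / q) with hl₁
  set l₀ := Real.log ((1 - p) / (1 - q)) with hl₀
  let lam : Bool → ℝ := fun b => if b then l₁ else l₀
  let h : E → Bool → ℝ := fun e b => Real.sqrt (bern (u e) b * bern (v e) b)
  -- Normalising constant of √(Ber(u e) Ber(v e)): the affinity where the coordinate changes, 1
  -- where it does not.
  let Z : E → ℝ := fun e => z ^ (s e ^ 2)
  have hZpos : ∀ e, 0 < Z e := fun e => Real.rpow_pos_of_pos hz _
  have hsum : ∀ e, ∑ b, h e b = Z e := by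
    intro e
    rcases hs e with ⟨h1, h2, h3⟩ | ⟨h1, h2, h3⟩ | ⟨h1, h2, h3, h4⟩
    · simp [h, Z, h1, h2, h3, bern, hz', hh₁, hh₀]
    · simp [h, Z, h1, h2, h3, bern, hz', hh₁, hh₀, mul_comm]
    · simp [h, Z, h1, ← h2, bern, h3, h4]
  have hZprod : ∏ e, Z e = Real.exp (-(m * I)) := by
    rw [← Real.rpow_sum_of_pos hz, hs2, hzd, hellingerAffinity_eq_exp hz, ← Real.exp_mul]
    congr 1; ring
  let w : E → Bool → ℝ := fun e b => h e b / Z e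
  let mu : ℝ := (h₁ * l₁ + h₀ * l₀) / z
  let g : E → Bool → ℝ := fun e b => s e * (lam b - mu)
  have hw : ∀ e, ∑ b, w e b = 1 := fun e => by
    simp only [w]; rw [← Finset.sum_div, hsum, div_self (hZpos e).ne']
  have hg : ∀ e, ∑ b, w e b * g e b = 0 := by
    intro e
    rcases hs e with ⟨h1, h2, h3⟩ | ⟨h1, h2, h3⟩ | ⟨h1, h2, h3, h4⟩
    · simp [w, g, lam, mu, h, Z, h1, h2, h3, bern, ← hh₁, ← hh₀]
      field_simp; rw [hz']; ring
    · simp [w, g, lam, mu, h, Z, h1, h2, h3, bern, mul_comm q p, mul_comm (1 - q) (1 - p), ← hh₁, ← hh₀]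
      field_simp; rw [hz']; ring
    · simp [g, h1]
  have hvar : ∀ e, ∑ b, w e b * g e b ^ 2 = s e ^ 2 * (h₁ * h₀ * (l₁ - l₀) ^ 2 / z ^ 2) := by
    intro e
    rcases hs e with ⟨h1, h2, h3⟩ | ⟨h1, h2, h3⟩ | ⟨h1, h2, h3, h4⟩
    · simp [w, g, lam, mu, h, Z, h1, h2, h3, bern, ← hh₁, ← hh₀]
      field_simp; rw [hz']; ring
    · simp [w, g, lam, mu, h, Z, h1, h2, h3, bern, mul_comm q p, mul_comm (1 - q) (1 - p), ← hh₁, ← hh₀]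
      field_simp; rw [hz']; ring
    · simp [g, h1]
  have hV : h₁ * h₀ * (l₁ - l₀) ^ 2 / z ^ 2 ≤ 12 * I + 32 * I ^ 2 := by
    rw [div_le_iff₀ (by positivity), mul_comm _ (z ^ 2)]
    exact llr_variance_le hq0 hqp hp1 hz
  have hsec := sum_prod_mul_sq w g hw hg
  rw [Finset.sum_congr rfl (fun e _ => hvar e), ← Finset.sum_mul, hs2] at hsec
  -- The tilted law is symmetric in p and q, so each signed increment has mean s e * mu. As the
  -- signs sum to zero, the means cancel and the log-likelihood ratio is already centred; this is
  -- where balance is needed.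
  have hgs : ∀ ω : E → Bool, ∑ e, g e (ω e) = ∑ e, s e * lam (ω e) := by
    intro ω
    simp only [g, mul_sub, Finset.sum_sub_distrib]
    rw [← Finset.sum_mul, hs0]; ring
  have hhw : ∀ ω : E → Bool, ∏ e, h e (ω e) = Real.exp (-(m * I)) * ∏ e, w e (ω e) := by
    intro ω
    simp only [w]
    rw [Finset.prod_div_distrib, hZprod]; field_simp
  have hpt : ∀ ω : E → Bool, Real.exp (-c) * ((∏ e, h e (ω e)) * (1 + c / 2) -
      (∏ e, h e (ω e)) * (∑ e, s e * lam (ω e)) ^ 2 / (8 * c)) ≤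
      min (∏ e, bern (u e) (ω e)) (∏ e, bern (v e) (ω e)) := by
    intro ω
    have hu' : ∀ e, 0 ≤ bern (u e) (ω e) := fun e => bern_nonneg (hu e).1 (hu e).2 _
    have hv' : ∀ e, 0 ≤ bern (v e) (ω e) := fun e => bern_nonneg (hv e).1 (hv e).2 _
    have e1 : ∏ e, h e (ω e) =
        Real.sqrt ((∏ e, bern (u e) (ω e)) * (∏ e, bern (v e) (ω e))) := by
      rw [← Finset.prod_mul_distrib, Real.sqrt_eq_rpow,
        ← Real.finsetProd_rpow _ _ (fun e _ => mul_nonneg (hu' e) (hv' e))]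
      simp [h, Real.sqrt_eq_rpow]
    rw [e1]
    apply le_min_of_llr (Finset.prod_nonneg fun e _ => hu' e)
      (Finset.prod_nonneg fun e _ => hv' e) hc
    intro ha hb
    rw [← Finset.prod_div_distrib, Real.log_prod]
    · refine Finset.sum_congr rfl fun e _ => ?_
      rcases hs e with ⟨h1, h2, h3⟩ | ⟨h1, h2, h3⟩ | ⟨h1, h2, h3, h4⟩
      · rw [h1, h2, h3]; cases ω e <;> simp [bern, lam, hl₁, hl₀]
      · rw [h1, h2, h3]; cases ω e <;> simp [bern, lam, hl₁, hl₀, ← Real.log_inv]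
      · rw [h1, h2]
        rcases eq_or_ne (bern (v e) (ω e)) 0 with h0 | h0 <;> simp [h0]
    · intro e _
      have := Finset.prod_ne_zero_iff.1 ha.ne' e (Finset.mem_univ e)
      have := Finset.prod_ne_zero_iff.1 hb.ne' e (Finset.mem_univ e)
      positivity
  unfold overlap
  refine le_trans ?_ (Finset.sum_le_sum fun ω _ => hpt ω)
  rw [← Finset.mul_sum, Finset.sum_sub_distrib, ← Finset.sum_mul, ← Finset.sum_div]
  simp_rw [hhw, mul_assoc, ← hgs]
  rw [← Finset.mul_sum, ← Finset.mul_sum, hsec, sum_prod_fun w]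
  simp only [hw, Finset.prod_const_one]
  have : Real.exp (-(m * I + c)) = Real.exp (-c) * Real.exp (-(m * I)) := by
    rw [← Real.exp_add]; congr 1; ring
  rw [this]
  apply mul_le_mul_of_nonneg_left _ (Real.exp_pos _).le
  -- The hypothesis on c makes the variance term at most c/2, exactly the surplus in 1 + c/2, so a
  -- factor at least 1 remains.
  have hfin : 2 * (m * (h₁ * h₀ * (l₁ - l₀) ^ 2 / z ^ 2)) / (8 * c) ≤ c / 2 := by
    rw [div_le_div_iff₀ (by positivity) (by norm_num)]
    have := mul_le_mul_of_nonneg_left hV hm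
    nlinarith
  have hm' : 2 * m * (h₁ * h₀ * (l₁ - l₀) ^ 2 / z ^ 2) = 2 * (m * (h₁ * h₀ * (l₁ - l₀) ^ 2 / z ^ 2)) := by ring
  have := mul_le_mul_of_nonneg_left hfin (Real.exp_pos (-(m * I))).le
  simp only [mul_assoc] at this ⊢
  rw [mul_div_assoc]
  linarith

/-- Overlap of two product laws in which at most `m` coordinates change from `p` to `q`, and at
most `m` from `q` to `p`. -/
lemma overlap_lower [DecidableEq E] {p q : ℝ} (hq0 : 0 ≤ q) (hqp : q < p) (hp1 : p ≤ 1)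
    (hz : 0 < hellingerAffinity p q) (u v : E → ℝ) (A B : Finset E) (hAB : Disjoint A B)
    (hA : ∀ e ∈ A, u e = p ∧ v e = q) (hB : ∀ e ∈ B, u e = q ∧ v e = p)
    (hN : ∀ e, e ∉ A → e ∉ B → u e = v e ∧ 0 ≤ u e ∧ u e ≤ 1)
    {m : ℕ} (hAm : A.card ≤ m) (hBm : B.card ≤ m) {c : ℝ} (hc : 0 < c)
    (hmc : m * (6 * renyiHalf p q + 16 * renyiHalf p q ^ 2) ≤ c ^ 2) :
    Real.exp (-(m * renyiHalf p q + c)) ≤ overlap u v := by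
  -- Dummy coordinates bring both directions of change to exactly m; they can only lower the
  -- overlap.
  let u' : Fin (m - A.card) ⊕ Fin (m - B.card) → ℝ := Sum.elim (fun _ => p) (fun _ => q)
  let v' : Fin (m - A.card) ⊕ Fin (m - B.card) → ℝ := Sum.elim (fun _ => q) (fun _ => p)
  let s' : Fin (m - A.card) ⊕ Fin (m - B.card) → ℝ := Sum.elim (fun _ => 1) (fun _ => -1)
  let s : E → ℝ := fun e => (if e ∈ A then 1 else 0) - (if e ∈ B then 1 else 0)
  have hs2 : ∀ e, s e ^ 2 = (if e ∈ A then 1 else 0) + (if e ∈ B then 1 else 0) := by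
    intro e
    by_cases h1 : e ∈ A
    · have := Finset.disjoint_left.1 hAB h1
      simp [s, h1, this]
    · by_cases h2 : e ∈ B <;> simp [s, h1, h2]
  refine le_trans ?_ (overlap_sum_le u v u' v')
  refine overlap_balanced hq0 hqp hp1 hz _ _ (Sum.elim s s') ?_ ?_ ?_ hc hmc (Nat.cast_nonneg m)
  · rintro (e | e | e)
    · by_cases h1 : e ∈ A
      · have := Finset.disjoint_left.1 hAB h1
        simp [s, h1, this, hA e h1]
      · by_cases h2 : e ∈ B
        · simp [s, h1, h2, hB e h2]
        · have := hN e h1 h2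
          simp [s, h1, h2, ← this.1, this.2]
    · simp [s', u', v']
    · simp [s', u', v']
  · rw [Fintype.sum_sum_type, Fintype.sum_sum_type]
    simp [s, s', Nat.cast_sub hAm, Nat.cast_sub hBm]
  · rw [Fintype.sum_sum_type, Fintype.sum_sum_type]
    simp [hs2, s', Nat.cast_sub hAm, Nat.cast_sub hBm, Finset.sum_add_distrib]
    ring

end Product

/-- The `0`-`1` matrix of a labelling. -/
def labelMatrix {n k : ℕ} (f : Fin n → Fin k) : Matrix (Fin n) (Fin k) ℝ :=
  Matrix.of fun i a => if f i = a then 1 else 0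

/-! ### Assignments as labellings, networks as edge vectors -/

section Label
variable {n k : ℕ}

lemma labelMatrix_apply (f : Fin n → Fin k) (i : Fin n) (a : Fin k) :
    labelMatrix f i a = if f i = a then 1 else 0 := rfl

lemma labelMatrix_mem_Pi0 (f : Fin n → Fin k) : labelMatrix f ∈ Pi0 n k := by
  refine ⟨fun i a => ?_, fun i => ?_⟩
  · rw [labelMatrix_apply]; split_ifs <;> simp
  · rw [Set.ncard_eq_one]
    exact ⟨f i, by ext a; simp [labelMatrix_apply, eq_comm]⟩

lemma exists_labelMatrix_eq {Z : Matrix (Fin n) (Fin k) ℝ} (hZ : Z ∈ Pi0 n k) :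
    ∃ f : Fin n → Fin k, labelMatrix f = Z := by
  have h := fun i => Set.ncard_eq_one.1 (hZ.2 i)
  choose f hf using h
  refine ⟨f, ?_⟩
  ext i a
  rw [labelMatrix_apply]
  have := Set.ext_iff.1 (hf i) a
  simp only [Set.mem_ofPred_eq, Set.mem_singleton_iff] at this
  split_ifs with h
  · rcases hZ.1 i a with h0 | h0
    · exact absurd h0 (this.2 h.symm)
    · exact h0.symm
  · by_contra h'
    exact h (this.1 (Ne.symm h')).symm

lemma communitySize_labelMatrix (f : Fin n → Fin k) (a : Fin k) :
    communitySize (labelMatrix f) a = (Finset.univ.filter fun i => f i = a).card := by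
  unfold communitySize
  rw [Set.ncard_eq_toFinset_card']
  congr 1
  ext i; simp [labelMatrix_apply]

lemma edgeProb_labelMatrix (p q : ℝ) (f : Fin n → Fin k) (i j : Fin n) :
    edgeProb p q (labelMatrix f) i j = if f i = f j then p else q := by
  simp only [edgeProb, Matrix.mul_apply, labelMatrix_apply, connectivity, Matrix.of_apply,
    Matrix.transpose_apply, mul_ite, mul_one, mul_zero, ite_mul, one_mul, zero_mul,
    Finset.sum_ite_eq, Finset.mem_univ, if_true]
  rw [Finset.sum_eq_single (f i)]
  · simp
  · intro c _ hc; simp [hc.symm]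
  · simp

end Label

/-- The unordered pairs `{i, j}`, represented by `i < j`. -/
abbrev EdgeIdx (n : ℕ) := {e : Fin n × Fin n // e.1 < e.2}

open Classical in
/-- A network on `[n]` is a choice of edges. -/
noncomputable def graphEquiv (n : ℕ) : SimpleGraph (Fin n) ≃ (EdgeIdx n → Bool) where
  toFun G e := decide (G.Adj e.1.1 e.1.2)
  invFun ω := SimpleGraph.fromRel fun i j => ∃ h : i < j, ω ⟨(i, j), h⟩ = true
  left_inv G := by
    ext i j
    simp only [SimpleGraph.fromRel_adj, decide_eq_true_eq]
    constructor
    · rintro ⟨_, ⟨_, h⟩ | ⟨_, h⟩⟩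
      · exact h
      · exact h.symm
    · intro h
      refine ⟨h.ne, ?_⟩
      rcases lt_or_gt_of_ne h.ne with hl | hl
      · exact Or.inl ⟨hl, h⟩
      · exact Or.inr ⟨hl, h.symm⟩
  right_inv ω := by
    ext ⟨⟨i, j⟩, h⟩
    simp only [SimpleGraph.fromRel_adj]
    have h' : ¬ j < i := not_lt.2 (le_of_lt h)
    have h : i < j := h
    simp [h, h', h.ne]

/-! ### Two networks whose assignments differ at one node -/

section Overlap
variable {n k : ℕ}

lemma prod_edges (F : Fin n → Fin n → ℝ) :
    ∏ i, ∏ j ∈ Finset.Ioi i, F i j = ∏ e : EdgeIdx n, F e.1.1 e.1.2 := by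
  rw [Finset.prod_sigma']
  symm
  refine Finset.prod_bij (fun e _ => ⟨e.1.1, e.1.2⟩) ?_ ?_ ?_ ?_
  · rintro ⟨⟨i, j⟩, h⟩ _; simpa using h
  · rintro ⟨⟨i, j⟩, h⟩ _ ⟨⟨i', j'⟩, h'⟩ _ he
    simpa using he
  · rintro ⟨i, j⟩ h
    exact ⟨⟨(i, j), by simpa using h⟩, Finset.mem_univ _, rfl⟩
  · intros; rfl

open Classical in
lemma sbmProb_labelMatrix (p q : ℝ) (f : Fin n → Fin k) (G : SimpleGraph (Fin n)) :
    sbmProb p q (labelMatrix f) G =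
      ∏ e : EdgeIdx n, bern (if f e.1.1 = f e.1.2 then p else q) (graphEquiv n G e) := by
  unfold sbmProb
  simp_rw [edgeProb_labelMatrix]
  rw [prod_edges (fun i j => if G.Adj i j then (if f i = f j then p else q)
    else 1 - if f i = f j then p else q)]
  refine Finset.prod_congr rfl fun e _ => ?_
  simp [bern, graphEquiv]

lemma sbmProb_nonneg {p q : ℝ} (hq0 : 0 ≤ q) (hqp : q < p) (hp1 : p ≤ 1)
    (f : Fin n → Fin k) (G : SimpleGraph (Fin n)) : 0 ≤ sbmProb p q (labelMatrix f) G := by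
  rw [sbmProb_labelMatrix]
  refine Finset.prod_nonneg fun e _ => bern_nonneg ?_ ?_ _ <;> split_ifs <;> linarith

open Classical in
/-- Overlap of the laws of two networks whose assignments differ only at the node `i`. -/
lemma sum_min_sbmProb_ge {p q : ℝ} (hq0 : 0 ≤ q) (hqp : q < p) (hp1 : p ≤ 1)
    (hz : 0 < hellingerAffinity p q) (f f' : Fin n → Fin k) (i : Fin n) {a b : Fin k}
    (hab : a ≠ b) (hfi : f i = a) (hfi' : f' i = b) (hff : ∀ j, j ≠ i → f j = f' j) {m : ℕ}
    (ha : (Finset.univ.filter fun j => j ≠ i ∧ f j = a).card ≤ m)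
    (hb : (Finset.univ.filter fun j => j ≠ i ∧ f j = b).card ≤ m) {c : ℝ} (hc : 0 < c)
    (hmc : m * (6 * renyiHalf p q + 16 * renyiHalf p q ^ 2) ≤ c ^ 2) :
    Real.exp (-(m * renyiHalf p q + c)) ≤
      ∑ G : SimpleGraph (Fin n),
        min (sbmProb p q (labelMatrix f) G) (sbmProb p q (labelMatrix f') G) := by
  simp_rw [sbmProb_labelMatrix]
  rw [(graphEquiv n).sum_comp (fun ω => min
    (∏ e : EdgeIdx n, bern (if f e.1.1 = f e.1.2 then p else q) (ω e))
    (∏ e : EdgeIdx n, bern (if f' e.1.1 = f' e.1.2 then p else q) (ω e)))]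
  let other : EdgeIdx n → Fin n := fun e => if e.1.1 = i then e.1.2 else e.1.1
  -- Only edges at i change: those to nodes labelled a go from p to q, those to nodes labelled b
  -- from q to p.
  let A : Fin k → Finset (EdgeIdx n) := fun d => Finset.univ.filter fun e =>
    (e.1.1 = i ∨ e.1.2 = i) ∧ f (other e) = d
  have hA : ∀ d, (A d).card ≤ (Finset.univ.filter fun j => j ≠ i ∧ f j = d).card := by
    intro d
    refine Finset.card_le_card_of_injOn other ?_ ?_
    · rintro ⟨⟨x, y⟩, h⟩ he
      have h : x < y := h
      simp only [A, other, Finset.coe_filter, Finset.mem_univ, true_and, Set.mem_ofPred_eq] at he ⊢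
      refine ⟨?_, he.2⟩
      rcases he.1 with rfl | rfl
      · simpa using h.ne'
      · simp [h.ne]
    · rintro ⟨⟨x, y⟩, h⟩ he ⟨⟨x', y'⟩, h'⟩ he' hee
      have h : x < y := h
      have h' : x' < y' := h'
      simp only [A, other, Finset.coe_filter, Finset.mem_univ, true_and, Set.mem_ofPred_eq]
        at he he' hee
      have : x = x' ∧ y = y' := by
        split_ifs at hee <;> grind
      simp [this]
  refine overlap_lower hq0 hqp hp1 hz _ _ (A a) (A b) ?_ ?_ ?_ ?_
    ((hA a).trans ha) ((hA b).trans hb) hc hmc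
  · rw [Finset.disjoint_left]
    intro e h1 h2
    simp only [A, Finset.mem_filter] at h1 h2
    exact hab (h1.2.2.symm.trans h2.2.2)
  · rintro ⟨⟨x, y⟩, h⟩ he
    have h : x < y := h
    simp only [A, other, Finset.mem_filter, Finset.mem_univ, true_and] at he ⊢
    rcases he with ⟨rfl | rfl, he⟩
    · have := hff y h.ne'
      grind
    · have := hff x h.ne
      grind
  · rintro ⟨⟨x, y⟩, h⟩ he
    have h : x < y := h
    simp only [A, other, Finset.mem_filter, Finset.mem_univ, true_and] at he ⊢
    rcases he with ⟨rfl | rfl, he⟩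
    · have := hff y h.ne'
      grind
    · have := hff x h.ne
      grind
  · rintro ⟨⟨x, y⟩, h⟩ h1 h2
    have h : x < y := h
    simp only [A, other, Finset.mem_filter, Finset.mem_univ, true_and] at h1 h2 ⊢
    refine ⟨?_, by split_ifs <;> linarith, by split_ifs <;> linarith⟩
    by_cases hx : x = i
    · have := hff y (by rw [← hx]; exact h.ne')
      grind
    · by_cases hy : y = i
      · have := hff x hx
        grind
      · rw [hff x hx, hff y hy]

end Overlap

/-! ### Loss by rows, and removal of the relabelling -/

section Loss
variable {n k : ℕ}

/-- The loss in row `i` after relabelling, for an assignment in `Π₁` against a labelling. -/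
def rowLoss (π : Matrix (Fin n) (Fin k) ℝ) (φ : Equiv.Perm (Fin k)) (f : Fin n → Fin k)
    (i : Fin n) : ℝ := 2 - 2 * π i (φ.symm (f i))

lemma sum_abs_row_eq {π : Matrix (Fin n) (Fin k) ℝ} (hπ : π ∈ Pi1 n k)
    (φ : Equiv.Perm (Fin k)) (f : Fin n → Fin k) (i : Fin n) :
    ∑ a, |π i a - labelMatrix f i (φ a)| = rowLoss π φ f i := by
  have hs : ∑ a, π i a = 1 := by
    rw [← hπ.2 i]
    exact Finset.sum_congr rfl fun a _ => (abs_of_nonneg (hπ.1 i a).1).symm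
  have h : ∀ a, |π i a - labelMatrix f i (φ a)| =
      π i a + if a = φ.symm (f i) then 1 - 2 * π i a else 0 := by
    intro a
    have h1 := hπ.1 i a
    rw [labelMatrix_apply]
    have : f i = φ a ↔ a = φ.symm (f i) := by
      rw [Equiv.eq_symm_apply, eq_comm]
    simp only [this]
    split_ifs
    · rw [abs_of_nonpos (by linarith)]; ring
    · rw [sub_zero, abs_of_nonneg h1.1, add_zero]
  simp_rw [h]
  rw [Finset.sum_add_distrib, hs]
  simp [rowLoss]
  ring

lemma loss_labelMatrix {π : Matrix (Fin n) (Fin k) ℝ} (hπ : π ∈ Pi1 n k) (f : Fin n → Fin k) :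
    loss π (labelMatrix f) = ⨅ φ : Equiv.Perm (Fin k), ∑ i, rowLoss π φ f i := by
  simp only [loss, sum_abs_row_eq hπ]

lemma rowLoss_nonneg {π : Matrix (Fin n) (Fin k) ℝ} (hπ : π ∈ Pi1 n k)
    (φ : Equiv.Perm (Fin k)) (f : Fin n → Fin k) (i : Fin n) : 0 ≤ rowLoss π φ f i := by
  have := (hπ.1 i (φ.symm (f i))).2
  unfold rowLoss; linarith

lemma rowLoss_le_two {π : Matrix (Fin n) (Fin k) ℝ} (hπ : π ∈ Pi1 n k)
    (φ : Equiv.Perm (Fin k)) (f : Fin n → Fin k) (i : Fin n) : rowLoss π φ f i ≤ 2 := by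
  have := (hπ.1 i (φ.symm (f i))).1
  unfold rowLoss; linarith

lemma two_le_rowLoss_add {π : Matrix (Fin n) (Fin k) ℝ} (hπ : π ∈ Pi1 n k)
    {φ φ' : Equiv.Perm (Fin k)} {f f' : Fin n → Fin k} {i : Fin n}
    (h : φ.symm (f i) ≠ φ'.symm (f' i)) : 2 ≤ rowLoss π φ f i + rowLoss π φ' f' i := by
  have hs : ∑ a, π i a = 1 := by
    rw [← hπ.2 i]
    exact Finset.sum_congr rfl fun a _ => (abs_of_nonneg (hπ.1 i a).1).symm
  have h2 : π i (φ.symm (f i)) + π i (φ'.symm (f' i)) ≤ 1 := by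
    rw [← hs, ← Finset.sum_pair h]
    exact Finset.sum_le_sum_of_subset_of_nonneg (Finset.subset_univ _)
      fun a _ _ => (hπ.1 i a).1
  unfold rowLoss; linarith

/-- If the labelling is known outside a small set `T` and takes two values on `T`, the relabelling
can be chosen from the estimate alone. -/
lemma exists_perm_sum_rowLoss_le {π : Matrix (Fin n) (Fin k) ℝ} (hπ : π ∈ Pi1 n k)
    (f₀ : Fin n → Fin k) (T : Finset (Fin n)) (a b : Fin k)
    (ha : 2 * T.card ≤ (Tᶜ.filter fun i => f₀ i = a).card)
    (hb : 2 * T.card ≤ (Tᶜ.filter fun i => f₀ i = b).card) :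
    ∃ ψ : Equiv.Perm (Fin k), ∀ f : Fin n → Fin k, (∀ i ∉ T, f i = f₀ i) →
      (∀ i ∈ T, f i = a ∨ f i = b) → ∑ i ∈ T, rowLoss π ψ f i ≤ loss π (labelMatrix f) := by
  -- Choose ψ as the best relabelling outside T, where all candidate labellings coincide.
  obtain ⟨ψ, hψ⟩ := Finite.exists_min fun φ : Equiv.Perm (Fin k) => ∑ i ∈ Tᶜ, rowLoss π φ f₀ i
  refine ⟨ψ, fun f hf hT => ?_⟩
  rw [loss_labelMatrix hπ]
  refine le_ciInf fun φ => ?_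
  rw [← Finset.sum_add_sum_compl T]
  have hc : ∑ i ∈ Tᶜ, rowLoss π φ f i = ∑ i ∈ Tᶜ, rowLoss π φ f₀ i := by
    refine Finset.sum_congr rfl fun i hi => ?_
    simp [rowLoss, hf i (Finset.mem_compl.1 hi)]
  rw [hc]
  have hpos : 0 ≤ ∑ i ∈ Tᶜ, rowLoss π φ f₀ i :=
    Finset.sum_nonneg fun i _ => rowLoss_nonneg hπ _ _ _
  have hpos' : 0 ≤ ∑ i ∈ T, rowLoss π φ f i :=
    Finset.sum_nonneg fun i _ => rowLoss_nonneg hπ _ _ _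
  have hle : ∑ i ∈ T, rowLoss π ψ f i ≤ 2 * T.card := by
    rw [mul_comm, ← nsmul_eq_mul]
    exact Finset.sum_le_card_nsmul _ _ _ fun i _ => rowLoss_le_two hπ _ _ _
  -- If φ and ψ disagree on d, every row labelled d outside T costs at least 2 under the two
  -- together. By minimality of ψ at least half of the total falls on φ, already as much as ψ can
  -- lose on all of T.
  have far : ∀ d : Fin k, φ.symm d ≠ ψ.symm d →
      2 * T.card ≤ (Tᶜ.filter fun i => f₀ i = d).card →
      (2 * T.card : ℝ) ≤ ∑ i ∈ Tᶜ, rowLoss π φ f₀ i := by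
    intro d hd hcard
    have h1 : (2 : ℝ) * (Tᶜ.filter fun i => f₀ i = d).card ≤
        ∑ i ∈ Tᶜ, (rowLoss π φ f₀ i + rowLoss π ψ f₀ i) := by
      calc (2 : ℝ) * (Tᶜ.filter fun i => f₀ i = d).card
          = (Tᶜ.filter fun i => f₀ i = d).card • (2 : ℝ) := by rw [nsmul_eq_mul, mul_comm]
        _ ≤ ∑ i ∈ Tᶜ.filter fun i => f₀ i = d, (rowLoss π φ f₀ i + rowLoss π ψ f₀ i) := by
            refine Finset.card_nsmul_le_sum _ _ _ fun i hi => two_le_rowLoss_add hπ ?_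
            rwa [(Finset.mem_filter.1 hi).2]
        _ ≤ _ := Finset.sum_le_sum_of_subset_of_nonneg (Finset.filter_subset _ _)
            fun i _ _ => add_nonneg (rowLoss_nonneg hπ _ _ _) (rowLoss_nonneg hπ _ _ _)
    rw [Finset.sum_add_distrib] at h1
    have h2 := hψ φ
    have h3 : ((2 * T.card : ℕ) : ℝ) ≤ (Tᶜ.filter fun i => f₀ i = d).card := by exact_mod_cast hcard
    push_cast at h3
    linarith
  by_cases h1 : φ.symm a = ψ.symm a
  · by_cases h2 : φ.symm b = ψ.symm b
    · have : ∑ i ∈ T, rowLoss π ψ f i = ∑ i ∈ T, rowLoss π φ f i := by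
        refine Finset.sum_congr rfl fun i hi => ?_
        rcases hT i hi with h | h <;> simp [rowLoss, h, h1, h2]
      linarith
    · linarith [far b h2 hb]
  · linarith [far a h1 ha]

end Loss

/-! ### Bayes risk over two middle layers -/

section Bayes
variable {n k : ℕ}

/-- The labelling that agrees with `f₀` outside `T`, is `a` on `S` and `b` on `T \ S`. -/
def relabel (f₀ : Fin n → Fin k) (T : Finset (Fin n)) (a b : Fin k) (S : Finset (Fin n))
    (i : Fin n) : Fin k := if i ∈ T then (if i ∈ S then a else b) else f₀ i

/-- Double counting of the pairs `(S, S ∪ {i})` in two consecutive layers. -/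
lemma sum_layers (T : Finset (Fin n)) (t : ℕ) (r : Finset (Fin n) → Fin n → ℝ) :
    ∑ S ∈ T.powersetCard (t + 1), ∑ i ∈ S, r S i =
      ∑ S ∈ T.powersetCard t, ∑ i ∈ T \ S, r (insert i S) i := by
  rw [Finset.sum_sigma', Finset.sum_sigma']
  refine Finset.sum_bij' (fun x _ => ⟨x.1.erase x.2, x.2⟩) (fun x _ => ⟨insert x.2 x.1, x.2⟩)
    ?_ ?_ ?_ ?_ ?_
  · rintro ⟨S, i⟩ h
    simp only [Finset.mem_sigma, Finset.mem_powersetCard, Finset.mem_sdiff] at h ⊢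
    refine ⟨⟨(Finset.erase_subset _ _).trans h.1.1, ?_⟩, h.1.1 h.2, Finset.notMem_erase _ _⟩
    rw [Finset.card_erase_of_mem h.2, h.1.2]; rfl
  · rintro ⟨S, i⟩ h
    simp only [Finset.mem_sigma, Finset.mem_powersetCard, Finset.mem_sdiff] at h ⊢
    refine ⟨⟨Finset.insert_subset h.2.1 h.1.1, ?_⟩, Finset.mem_insert_self _ _⟩
    rw [Finset.card_insert_of_notMem h.2.2, h.1.2]
  · rintro ⟨S, i⟩ h
    simp only [Finset.mem_sigma] at h
    simp [Finset.insert_erase h.2]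
  · rintro ⟨S, i⟩ h
    simp only [Finset.mem_sigma, Finset.mem_sdiff] at h
    simp [Finset.erase_insert h.2.2]
  · rintro ⟨S, i⟩ h
    simp only [Finset.mem_sigma] at h
    simp [Finset.insert_erase h.2]

open Classical in
/-- Bayes lower bound for the uniform prior on the labellings `relabel f₀ T a b S` with `S` in the
two middle layers of `T`. -/
lemma bayes_lower {p q : ℝ} (hq0 : 0 ≤ q) (hqp : q < p) (hp1 : p ≤ 1)
    (f₀ : Fin n → Fin k) (T : Finset (Fin n)) {a b : Fin k} (hab : a ≠ b) {t : ℕ}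
    (hT : T.card = 2 * t + 1)
    (ha : 2 * T.card ≤ (Tᶜ.filter fun i => f₀ i = a).card)
    (hb : 2 * T.card ≤ (Tᶜ.filter fun i => f₀ i = b).card)
    {κ : ℝ} (hκ : ∀ S ∈ T.powersetCard t, ∀ i ∈ T \ S,
      κ ≤ ∑ G : SimpleGraph (Fin n), min (sbmProb p q (labelMatrix (relabel f₀ T a b S)) G)
        (sbmProb p q (labelMatrix (relabel f₀ T a b (insert i S))) G))
    (πhat : SimpleGraph (Fin n) → Pi1 n k) {M : ℝ}
    (hM : ∀ S ∈ T.powersetCard t ∪ T.powersetCard (t + 1),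
      expectedLoss p q πhat (labelMatrix (relabel f₀ T a b S)) ≤ M) :
    (t + 1) * κ ≤ M := by
  choose ψ hψ using fun G => exists_perm_sum_rowLoss_le (πhat G).2 f₀ T a b ha hb
  let F : Finset (Fin n) → Fin n → Fin k := relabel f₀ T a b
  let r : Finset (Fin n) → Fin n → ℝ := fun S i =>
    ∑ G, sbmProb p q (labelMatrix (F S)) G * rowLoss (πhat G).1 (ψ G) (F S) i
  have hP : ∀ S G, 0 ≤ sbmProb p q (labelMatrix (F S)) G :=
    fun S G => sbmProb_nonneg hq0 hqp hp1 _ _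
  have hr0 : ∀ S i, 0 ≤ r S i := fun S i =>
    Finset.sum_nonneg fun G _ => mul_nonneg (hP S G) (rowLoss_nonneg (πhat G).2 _ _ _)
  have hrisk : ∀ S, ∑ i ∈ T, r S i ≤ expectedLoss p q πhat (labelMatrix (F S)) := by
    intro S
    simp only [r, expectedLoss]
    rw [Finset.sum_comm]
    refine Finset.sum_le_sum fun G _ => ?_
    rw [← Finset.mul_sum]
    refine mul_le_mul_of_nonneg_left (hψ G (F S) ?_ ?_) (hP S G)
    · intro i hi; simp [F, relabel, hi]
    · intro i hi
      simp only [F, relabel, hi, if_true]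
      split_ifs <;> simp
  have hpair : ∀ S ∈ T.powersetCard t, ∀ i ∈ T \ S, 2 * κ ≤ r S i + r (insert i S) i := by
    intro S hS i hi
    rw [Finset.mem_sdiff] at hi
    have h1 : F S i = b := by simp [F, relabel, hi]
    have h2 : F (insert i S) i = a := by simp [F, relabel, hi]
    calc 2 * κ ≤ 2 * ∑ G : SimpleGraph (Fin n), min (sbmProb p q (labelMatrix (F S)) G)
          (sbmProb p q (labelMatrix (F (insert i S))) G) := by
          have := hκ S hS i (Finset.mem_sdiff.2 hi)
          linarith
      _ ≤ _ := by
          simp only [r]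
          rw [← Finset.sum_add_distrib, Finset.mul_sum]
          refine Finset.sum_le_sum fun G _ => ?_
          have h3 : 2 ≤ rowLoss (πhat G).1 (ψ G) (F S) i +
              rowLoss (πhat G).1 (ψ G) (F (insert i S)) i := by
            refine two_le_rowLoss_add (πhat G).2 ?_
            rw [h1, h2]
            exact fun h => hab ((ψ G).symm.injective h).symm
          have h4 := rowLoss_nonneg (πhat G).2 (ψ G) (F S) i
          have h5 := rowLoss_nonneg (πhat G).2 (ψ G) (F (insert i S)) i
          have h6 : 0 ≤ min (sbmProb p q (labelMatrix (F S)) G)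
            (sbmProb p q (labelMatrix (F (insert i S))) G) := le_min (hP _ _) (hP _ _)
          have h7 := mul_le_mul_of_nonneg_right (min_le_left (sbmProb p q (labelMatrix (F S)) G)
            (sbmProb p q (labelMatrix (F (insert i S))) G)) h4
          have h8 := mul_le_mul_of_nonneg_right (min_le_right (sbmProb p q (labelMatrix (F S)) G)
            (sbmProb p q (labelMatrix (F (insert i S))) G)) h5
          nlinarith [mul_le_mul_of_nonneg_left h3 h6]
  have hchoose : (2 * t + 1).choose (t + 1) = (2 * t + 1).choose t := by
    rw [← Nat.choose_symm_of_eq_add]; omega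
  have hupper : ∑ S ∈ T.powersetCard t, ∑ i ∈ T, r S i +
      ∑ S ∈ T.powersetCard (t + 1), ∑ i ∈ T, r S i ≤ 2 * (2 * t + 1).choose t * M := by
    have e1 : ∑ S ∈ T.powersetCard t, ∑ i ∈ T, r S i ≤ (2 * t + 1).choose t * M := by
      rw [← hT, ← Finset.card_powersetCard, ← nsmul_eq_mul]
      exact Finset.sum_le_card_nsmul _ _ _ fun S hS =>
        (hrisk S).trans (hM S (Finset.mem_union_left _ hS))
    have e2 : ∑ S ∈ T.powersetCard (t + 1), ∑ i ∈ T, r S i ≤ (2 * t + 1).choose t * M := by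
      rw [← hchoose, ← hT, ← Finset.card_powersetCard, ← nsmul_eq_mul]
      exact Finset.sum_le_card_nsmul _ _ _ fun S hS =>
        (hrisk S).trans (hM S (Finset.mem_union_right _ hS))
    linarith
  -- Each S in layer t is charged on the t+1 nodes of T \ S, each set in layer t+1 on its own t+1
  -- nodes, so every adjacent pair is counted once.
  have hlower : (2 * t + 1).choose t * ((t + 1) * (2 * κ)) ≤
      ∑ S ∈ T.powersetCard t, ∑ i ∈ T, r S i +
        ∑ S ∈ T.powersetCard (t + 1), ∑ i ∈ T, r S i := by
    have e1 : ∑ S ∈ T.powersetCard (t + 1), ∑ i ∈ S, r S i ≤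
        ∑ S ∈ T.powersetCard (t + 1), ∑ i ∈ T, r S i :=
      Finset.sum_le_sum fun S hS => Finset.sum_le_sum_of_subset_of_nonneg
        (Finset.mem_powersetCard.1 hS).1 fun i _ _ => hr0 S i
    have e2 : ∑ S ∈ T.powersetCard t, ∑ i ∈ T \ S, r S i ≤
        ∑ S ∈ T.powersetCard t, ∑ i ∈ T, r S i :=
      Finset.sum_le_sum fun S hS => Finset.sum_le_sum_of_subset_of_nonneg
        Finset.sdiff_subset fun i _ _ => hr0 S i
    rw [sum_layers T t r] at e1
    have e3 : (2 * t + 1).choose t * ((t + 1) * (2 * κ)) ≤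
        ∑ S ∈ T.powersetCard t, ∑ i ∈ T \ S, (r S i + r (insert i S) i) := by
      rw [← hT, ← Finset.card_powersetCard, ← nsmul_eq_mul]
      refine Finset.card_nsmul_le_sum _ _ _ fun S hS => ?_
      have hcard : (T \ S).card = t + 1 := by
        have := Finset.mem_powersetCard.1 hS
        rw [Finset.card_sdiff_of_subset this.1]; omega
      have := Finset.card_nsmul_le_sum (T \ S) _ _ (hpair S hS)
      rw [hcard, nsmul_eq_mul] at this
      exact_mod_cast this
    simp only [Finset.sum_add_distrib] at e3
    linarith
  have hpos : (0 : ℝ) < (2 * t + 1).choose t := by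
    exact_mod_cast Nat.choose_pos (by omega)
  have := hlower.trans hupper
  have h9 : ((2 * t + 1).choose t : ℝ) * ((t + 1) * κ) ≤ (2 * t + 1).choose t * M := by linarith
  exact le_of_mul_le_mul_left h9 hpos

end Bayes

/-! ### Non-asymptotic minimax bound -/

section Risk
variable {n k : ℕ}

/-- The number of nodes with label `d`. -/
def labelCount (f : Fin n → Fin k) (d : Fin k) : ℕ := (Finset.univ.filter fun i => f i = d).card

lemma labelMatrix_mem_Pi0Sized {ρ ρ' : ℝ} (f : Fin n → Fin k)
    (h : ∀ d, ρ * n / k ≤ labelCount f d ∧ (labelCount f d : ℝ) ≤ ρ' * n / k) :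
    labelMatrix f ∈ Pi0Sized n k ρ ρ' := by
  refine ⟨labelMatrix_mem_Pi0 f, fun d => ?_⟩
  rw [communitySize_labelMatrix]
  exact h d

/-- There are only finitely many assignments. Boundedness matters because an unbounded real supremum
would default to 0. -/
lemma bddAbove_expectedLoss (p q ρ ρ' : ℝ) (πhat : SimpleGraph (Fin n) → Pi1 n k) :
    BddAbove (Set.range fun Z : Pi0Sized n k ρ ρ' =>
      expectedLoss p q πhat (Z : Matrix (Fin n) (Fin k) ℝ)) := by
  refine ((Set.finite_range fun f : Fin n → Fin k =>
    expectedLoss p q πhat (labelMatrix f)).subset ?_).bddAbove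
  rintro _ ⟨⟨Z, hZ⟩, rfl⟩
  obtain ⟨f, rfl⟩ := exists_labelMatrix_eq hZ.1
  exact ⟨f, rfl⟩

lemma nonempty_Pi1 (a : Fin k) : Nonempty (Pi1 n k) := by
  refine ⟨labelMatrix fun _ => a, fun i d => ?_, fun i => ?_⟩
  · rw [labelMatrix_apply]; split_ifs <;> norm_num
  · simp [labelMatrix_apply, apply_ite]

lemma labelCount_relabel_left (f : Fin n → Fin k) {T S : Finset (Fin n)} {a b : Fin k}
    (hab : a ≠ b) (hS : S ⊆ T) :
    labelCount (relabel f T a b S) a = (Tᶜ.filter fun i => f i = a).card + S.card := by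
  rw [labelCount, ← Finset.card_union_of_disjoint]
  · congr 1
    ext i
    have := @hS i
    simp only [relabel, Finset.mem_filter, Finset.mem_union, Finset.mem_compl]
    grind
  · rw [Finset.disjoint_left]
    intro i hi hiS
    simp only [Finset.mem_filter, Finset.mem_compl] at hi
    exact hi.1 (hS hiS)

lemma labelCount_relabel_right (f : Fin n → Fin k) {T S : Finset (Fin n)} {a b : Fin k}
    (hab : a ≠ b) :
    labelCount (relabel f T a b S) b = (Tᶜ.filter fun i => f i = b).card + (T \ S).card := by
  rw [labelCount, ← Finset.card_union_of_disjoint]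
  · congr 1
    ext i
    simp only [relabel, Finset.mem_filter, Finset.mem_union, Finset.mem_compl, Finset.mem_sdiff]
    grind
  · rw [Finset.disjoint_left]
    intro i hi hiS
    simp only [Finset.mem_filter, Finset.mem_compl, Finset.mem_sdiff] at hi hiS
    exact hi.1 hiS.1

lemma labelCount_relabel_other (f : Fin n → Fin k) {T S : Finset (Fin n)} {a b d : Fin k}
    (hT : ∀ i ∈ T, f i = a ∨ f i = b) (hda : d ≠ a) (hdb : d ≠ b) :
    labelCount (relabel f T a b S) d = labelCount f d := by
  unfold labelCount
  congr 1
  ext i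
  have := hT i
  simp only [relabel, Finset.mem_filter, Finset.mem_univ, true_and]
  grind

open Classical in
/-- Non-asymptotic lower bound: some node can be moved from community `a` to community `b` without
violating the size constraints. -/
theorem minimaxRisk_ge {p q ρ ρ' : ℝ} (hq0 : 0 ≤ q) (hqp : q < p) (hp1 : p ≤ 1)
    (hz : 0 < hellingerAffinity p q) (f : Fin n → Fin k) {a b : Fin k} (hab : a ≠ b) {t m : ℕ}
    (hsize : ∀ d, ρ * n / k ≤ labelCount f d ∧ (labelCount f d : ℝ) ≤ ρ' * n / k)
    (ha : ρ * n / k + 1 ≤ labelCount f a) (hb : (labelCount f b : ℝ) + 1 ≤ ρ' * n / k)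
    (hat : 5 * t + 3 ≤ labelCount f a) (hbt : 5 * t + 2 ≤ labelCount f b)
    (ham : labelCount f a ≤ m + 1) (hbm : labelCount f b ≤ m) {c : ℝ} (hc : 0 < c)
    (hmc : m * (6 * renyiHalf p q + 16 * renyiHalf p q ^ 2) ≤ c ^ 2) :
    (t + 1) * Real.exp (-(m * renyiHalf p q + c)) ≤ minimaxRisk n k p q ρ ρ' := by
  -- With t+1 nodes from a and t from b, layer t+1 reproduces the sizes of f and layer t moves one
  -- node from a to b. The thresholds 5t+3 and 5t+2 leave 2|T| = 4t+2 nodes of each label outside T.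
  obtain ⟨Ta, hTa, hTac⟩ := Finset.exists_subset_card_eq
    (show t + 1 ≤ (Finset.univ.filter fun i => f i = a).card from by
      unfold labelCount at hat; omega)
  obtain ⟨Tb, hTb, hTbc⟩ := Finset.exists_subset_card_eq
    (show t ≤ (Finset.univ.filter fun i => f i = b).card from by
      unfold labelCount at hbt; omega)
  have hTa' : ∀ i ∈ Ta, f i = a := fun i hi => (Finset.mem_filter.1 (hTa hi)).2
  have hTb' : ∀ i ∈ Tb, f i = b := fun i hi => (Finset.mem_filter.1 (hTb hi)).2
  have hdisj : Disjoint Ta Tb := by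
    rw [Finset.disjoint_left]
    intro i h1 h2
    exact hab ((hTa' i h1).symm.trans (hTb' i h2))
  set T := Ta ∪ Tb with hT
  have hTc : T.card = 2 * t + 1 := by
    rw [hT, Finset.card_union_of_disjoint hdisj, hTac, hTbc]; ring
  have hTab : ∀ i ∈ T, f i = a ∨ f i = b := by
    intro i hi
    rcases Finset.mem_union.1 hi with h | h
    · exact Or.inl (hTa' i h)
    · exact Or.inr (hTb' i h)
  have hca : (Tᶜ.filter fun i => f i = a).card + (t + 1) = labelCount f a := by
    rw [labelCount, ← hTac, ← Finset.card_union_of_disjoint]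
    · congr 1
      ext i
      have h1 := hTa' i
      have h2 := hTb' i
      simp only [hT, Finset.mem_union, Finset.mem_filter, Finset.mem_compl, Finset.mem_univ,
        true_and]
      grind
    · rw [Finset.disjoint_left]
      intro i h1 h2
      exact Finset.mem_compl.1 (Finset.mem_filter.1 h1).1 (Finset.mem_union_left _ h2)
  have hcb : (Tᶜ.filter fun i => f i = b).card + t = labelCount f b := by
    rw [labelCount, ← hTbc, ← Finset.card_union_of_disjoint]
    · congr 1
      ext i
      have h1 := hTa' i
      have h2 := hTb' i
      simp only [hT, Finset.mem_union, Finset.mem_filter, Finset.mem_compl, Finset.mem_univ,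
        true_and]
      grind
    · rw [Finset.disjoint_left]
      intro i h1 h2
      exact Finset.mem_compl.1 (Finset.mem_filter.1 h1).1 (Finset.mem_union_right _ h2)
  have hcount : ∀ S ⊆ T, labelCount (relabel f T a b S) a + (t + 1) = labelCount f a + S.card ∧
      labelCount (relabel f T a b S) b + S.card = labelCount f b + (t + 1) := by
    intro S hS
    rw [labelCount_relabel_left f hab hS, labelCount_relabel_right f hab,
      Finset.card_sdiff_of_subset hS]
    have := Finset.card_le_card hS
    omega
  have hmem : ∀ S ∈ T.powersetCard t ∪ T.powersetCard (t + 1),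
      labelMatrix (relabel f T a b S) ∈ Pi0Sized n k ρ ρ' := by
    intro S hS
    refine labelMatrix_mem_Pi0Sized _ fun d => ?_
    have hS' : S ⊆ T ∧ (S.card = t ∨ S.card = t + 1) := by
      simp only [Finset.mem_union, Finset.mem_powersetCard] at hS; tauto
    obtain ⟨h1, h2⟩ := hcount S hS'.1
    have hsa := hsize a
    have hsb := hsize b
    by_cases hda : d = a
    · subst hda
      rcases hS'.2 with h | h
      · have : labelCount f d = labelCount (relabel f T d b S) d + 1 := by omega
        rw [this] at ha hsa
        push_cast at ha hsa
        exact ⟨by linarith, by linarith⟩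
      · have : labelCount f d = labelCount (relabel f T d b S) d := by omega
        rwa [← this]
    · by_cases hdb : d = b
      · subst hdb
        rcases hS'.2 with h | h
        · have : labelCount (relabel f T a d S) d = labelCount f d + 1 := by omega
          rw [this]
          push_cast
          exact ⟨by linarith, by linarith⟩
        · have : labelCount f d = labelCount (relabel f T a d S) d := by omega
          rwa [← this]
      · rw [labelCount_relabel_other f hTab hda hdb]
        exact hsize d
  have : Nonempty (SimpleGraph (Fin n) → Pi1 n k) := by
    have := nonempty_Pi1 (n := n) a
    infer_instance
  refine le_ciInf fun πhat => ?_
  refine bayes_lower hq0 hqp hp1 f T hab hTc (by omega) (by omega) ?_ πhat ?_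
  · intro S hS i hi
    rw [Finset.mem_powersetCard] at hS
    rw [Finset.mem_sdiff] at hi
    have hins : insert i S ⊆ T := Finset.insert_subset hi.1 hS.1
    have hcard : (insert i S).card = t + 1 := by
      rw [Finset.card_insert_of_notMem hi.2, hS.2]
    obtain ⟨h1, h2⟩ := hcount _ hins
    have hia : relabel f T a b (insert i S) i = a := by simp [relabel, hi.1]
    simp_rw [min_comm (sbmProb p q (labelMatrix (relabel f T a b S)) _)]
    refine sum_min_sbmProb_ge hq0 hqp hp1 hz (relabel f T a b (insert i S)) (relabel f T a b S) i
      hab hia ?_ ?_ ?_ ?_ hc hmc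
    · simp [relabel, hi.1, hi.2]
    · intro j hj; simp [relabel, hj]
    -- The moved node is not its own neighbour, so community a may have m+1 members.
    · have e : (Finset.univ.filter fun j => j ≠ i ∧ relabel f T a b (insert i S) j = a) =
          (Finset.univ.filter fun j => relabel f T a b (insert i S) j = a).erase i := by
        ext j; simp
      rw [e, Finset.card_erase_of_mem (by simpa using hia)]
      unfold labelCount at h1 ham
      omega
    · refine (Finset.card_le_card (t := Finset.univ.filter fun j =>
        relabel f T a b (insert i S) j = b) ?_).trans ?_
      · intro j hj
        simp only [Finset.mem_filter, Finset.mem_univ, true_and] at hj ⊢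
        exact hj.2
      · unfold labelCount at h2 hbm
        omega
  · intro S hS
    exact le_ciSup (bddAbove_expectedLoss p q ρ ρ' πhat) ⟨_, hmem S hS⟩

end Risk

/-! ### Assignments with room to move a node -/

section Config
variable {n k : ℕ}

lemma sum_labelCount (f : Fin n → Fin k) : ∑ d, labelCount f d = n := by
  have := Finset.card_eq_sum_card_fiberwise (s := (Finset.univ : Finset (Fin n)))
    (t := (Finset.univ : Finset (Fin k))) (f := f) (by intro i _; simp)
  simpa [labelCount] using this.symm

lemma exists_labelCount_le (hk : 0 < k) (f : Fin n → Fin k) :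
    ∃ d, (labelCount f d : ℝ) ≤ (n : ℝ) / k := by
  by_contra! h
  have hk' : (0 : ℝ) < k := by exact_mod_cast hk
  have : Nonempty (Fin k) := ⟨⟨0, hk⟩⟩
  have h1 : ∑ d : Fin k, (n : ℝ) / k < ∑ d, (labelCount f d : ℝ) :=
    Finset.sum_lt_sum_of_nonempty Finset.univ_nonempty fun d _ => h d
  rw [← Nat.cast_sum, sum_labelCount] at h1
  simp at h1
  rw [mul_div_cancel₀ _ hk'.ne'] at h1
  exact lt_irrefl _ h1

lemma exists_le_labelCount (hk : 0 < k) (f : Fin n → Fin k) :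
    ∃ d, (n : ℝ) / k ≤ labelCount f d := by
  by_contra! h
  have hk' : (0 : ℝ) < k := by exact_mod_cast hk
  have : Nonempty (Fin k) := ⟨⟨0, hk⟩⟩
  have h1 : ∑ d, (labelCount f d : ℝ) < ∑ d : Fin k, (n : ℝ) / k :=
    Finset.sum_lt_sum_of_nonempty Finset.univ_nonempty fun d _ => h d
  rw [← Nat.cast_sum, sum_labelCount] at h1
  simp at h1
  rw [mul_div_cancel₀ _ hk'.ne'] at h1
  exact lt_irrefl _ h1

/-- From two small communities one obtains an assignment that still satisfies the size constraints
after one node has been moved between two small communities. -/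
lemma exists_movable_config {L U M : ℝ} (hroom : L + 1 ≤ (n : ℝ) / k ∧ (n : ℝ) / k + 1 ≤ U)
    (f : Fin n → Fin k) (hsize : ∀ d, L ≤ labelCount f d ∧ (labelCount f d : ℝ) ≤ U)
    {a b : Fin k} (hab : a ≠ b) (hM : (labelCount f a : ℝ) ≤ M ∧ (labelCount f b : ℝ) ≤ M)
    (hLM : L + 2 ≤ M) :
    ∃ (g : Fin n → Fin k) (c d : Fin k), c ≠ d ∧
      (∀ e, L ≤ labelCount g e ∧ (labelCount g e : ℝ) ≤ U) ∧ L + 1 ≤ labelCount g c ∧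
      (labelCount g d : ℝ) + 1 ≤ U ∧ (labelCount g c : ℝ) ≤ M ∧ (labelCount g d : ℝ) ≤ M := by
  have hk : 0 < k := a.pos
  wlog hle : labelCount f b ≤ labelCount f a generalizing a b
  · exact this hab.symm hM.symm (le_of_not_ge hle)
  have hle' : (labelCount f b : ℝ) ≤ labelCount f a := by exact_mod_cast hle
  by_cases h1 : L + 1 ≤ labelCount f a
  -- With a the larger of the two, a can give up a node. If b is too full to receive one, a
  -- community of at most average size receives it instead; it is smaller than b, hence also at most
  -- M.
  · by_cases h2 : (labelCount f b : ℝ) + 1 ≤ U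
    · exact ⟨f, a, b, hab, hsize, h1, h2, hM.1, hM.2⟩
    · obtain ⟨d, hd⟩ := exists_labelCount_le hk f
      push Not at h2
      have hda : a ≠ d := by rintro rfl; linarith [hroom.2]
      exact ⟨f, a, d, hda, hsize, h1, by linarith [hroom.2], hM.1, by linarith [hroom.2, hM.2]⟩
  · push Not at h1
    -- Both communities sit within one of the lower limit. Enlarging a by a node from a community of
    -- at least average size lets a be the donor; its size stays below L + 2 ≤ M.
    obtain ⟨c, hc⟩ := exists_le_labelCount hk f
    have hca : c ≠ a := by rintro rfl; linarith [hroom.1]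
    have hcb : c ≠ b := by rintro rfl; linarith [hroom.1]
    have hLpos : (0 : ℝ) < labelCount f c := by
      have : (0 : ℝ) ≤ labelCount f a := Nat.cast_nonneg _
      linarith [hroom.1]
    have : 0 < (Finset.univ.filter fun i => f i = c).card := by
      unfold labelCount at hLpos; exact_mod_cast hLpos
    obtain ⟨i, hi⟩ := Finset.card_pos.1 this
    have hi : f i = c := (Finset.mem_filter.1 hi).2
    let g := Function.update f i a
    have ga : labelCount g a = labelCount f a + 1 := by
      have : (Finset.univ.filter fun j => g j = a) =
          insert i (Finset.univ.filter fun j => f j = a) := by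
        ext j
        simp only [g, Function.update_apply, Finset.mem_filter, Finset.mem_univ, true_and,
          Finset.mem_insert]
        grind
      rw [labelCount, this, Finset.card_insert_of_notMem (by simp [hi, hca])]
      rfl
    have gc : labelCount g c + 1 = labelCount f c := by
      have : (Finset.univ.filter fun j => g j = c) =
          (Finset.univ.filter fun j => f j = c).erase i := by
        ext j
        simp only [g, Function.update_apply, Finset.mem_filter, Finset.mem_univ, true_and,
          Finset.mem_erase]
        grind
      rw [labelCount, this, Finset.card_erase_add_one (by simp [hi])]
      rfl
    have go : ∀ e, e ≠ a → e ≠ c → labelCount g e = labelCount f e := by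
      intro e h1 h2
      unfold labelCount
      congr 1
      ext j
      simp only [g, Function.update_apply, Finset.mem_filter, Finset.mem_univ, true_and]
      grind
    have ga' : (labelCount g a : ℝ) = labelCount f a + 1 := by exact_mod_cast ga
    have gc' : (labelCount g c : ℝ) + 1 = labelCount f c := by exact_mod_cast gc
    have hsa := hsize a
    refine ⟨g, a, b, hab, ?_, ?_, ?_, ?_, ?_⟩
    · intro e
      by_cases h2 : e = a
      · rw [h2, ga']; exact ⟨by linarith, by linarith [hroom.1, hroom.2]⟩
      · by_cases h3 : e = c
        · rw [h3]; exact ⟨by linarith [hroom.1], by linarith [(hsize c).2]⟩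
        · rw [go e h2 h3]; exact hsize e
    · linarith
    · rw [go b hab.symm hcb.symm]; linarith [hroom.1, hroom.2]
    · linarith
    · rw [go b hab.symm hcb.symm]; exact hM.2

/-- A balanced labelling with two labels. -/
lemma exists_balanced_labelling {a b : Fin k} (hab : a ≠ b) :
    ∃ f : Fin n → Fin k, labelCount f a = n - n / 2 ∧ labelCount f b = n / 2 := by
  obtain ⟨B, hB⟩ := Finset.exists_subset_card_eq
    (show n / 2 ≤ (Finset.univ : Finset (Fin n)).card by rw [Finset.card_univ, Fintype.card_fin]; omega)
  refine ⟨fun i => if i ∈ B then b else a, ?_, ?_⟩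
  · have : (Finset.univ.filter fun i => (if i ∈ B then b else a) = a) = Bᶜ := by
      ext i; simp [hab.symm]
    rw [labelCount, this, Finset.card_compl, hB.2, Fintype.card_fin]
  · have : (Finset.univ.filter fun i => (if i ∈ B then b else a) = b) = B := by
      ext i; simp [hab]
    rw [labelCount, this, hB.2]

end Config

/-! ### Passage to the limit -/

lemma exists_tendsto_zero_of_forall_eps {A R : ℕ → ℝ} (hA : ∀ᶠ n in atTop, 0 < A n)
    (h : ∀ ε : ℝ, 0 < ε → ∀ᶠ n : ℕ in atTop, n * Real.exp (-((1 + ε) * A n)) ≤ R n) :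
    ∃ η : ℕ → ℝ, Tendsto η atTop (𝓝 0) ∧
      ∀ᶠ n : ℕ in atTop, n * Real.exp (-((1 - η n) * A n)) ≤ R n := by
  -- Without the cap this η would give equality; capping at 0 keeps the bound and forces convergence
  -- when R is larger. One explicit sequence serves all ε, with no diagonal argument.
  refine ⟨fun n => min 0 (1 + Real.log (R n / n) / A n), ?_, ?_⟩
  · rw [Metric.tendsto_atTop']
    intro ε hε
    obtain ⟨N, hN⟩ := eventually_atTop.1 ((h (ε / 2) (by positivity)).and
      (hA.and (eventually_gt_atTop 0)))
    refine ⟨N, fun n hn => ?_⟩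
    obtain ⟨h1, h2, h3⟩ := hN n hn.le
    have h3 : (0 : ℝ) < n := by exact_mod_cast h3
    rw [Real.dist_eq, sub_zero, abs_of_nonpos (min_le_left _ _), neg_lt, lt_min_iff]
    refine ⟨by linarith, ?_⟩
    have h4 : Real.exp (-((1 + ε / 2) * A n)) ≤ R n / n := by
      rw [le_div_iff₀ h3]; linarith
    have h5 := (Real.le_log_iff_exp_le ((Real.exp_pos _).trans_le h4)).2 h4
    have h6 : -(1 + ε / 2) ≤ Real.log (R n / n) / A n := by
      rw [le_div_iff₀ h2]; linarith
    linarith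
  · filter_upwards [h 1 one_pos, hA, eventually_gt_atTop 0] with n h1 h2 h3
    have h3 : (0 : ℝ) < n := by exact_mod_cast h3
    have hR : 0 < R n / n := div_pos ((by positivity : (0 : ℝ) < _).trans_le h1) h3
    have h4 : -((1 - min 0 (1 + Real.log (R n / n) / A n)) * A n) ≤ Real.log (R n / n) := by
      have h5 : min 0 (1 + Real.log (R n / n) / A n) ≤ 1 + Real.log (R n / n) / A n :=
        min_le_right _ _
      have h6 := mul_le_mul_of_nonneg_right h5 h2.le
      rw [add_mul, div_mul_cancel₀ _ h2.ne'] at h6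
      linarith
    have h5 := (Real.le_log_iff_exp_le hR).1 h4
    rwa [le_div_iff₀ h3, mul_comm] at h5

lemma hellingerAffinity_pos_of_renyiHalf_pos {p q : ℝ} (h : 0 < renyiHalf p q) :
    0 < hellingerAffinity p q := by
  refine lt_of_le_of_ne (by unfold hellingerAffinity; positivity) fun h0 => ?_
  have : renyiHalf p q = -2 * Real.log (hellingerAffinity p q) := rfl
  rw [this, ← h0] at h
  simp at h

/-- Asymptotic form of `minimaxRisk_ge`: `ℓ n` is the size of the two communities between which
a node can be moved. -/
lemma eventually_minimaxRisk_ge (k : ℕ → ℕ) (p q ρ ρ' ℓ : ℕ → ℝ)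
    (hpq : ∀ n, 0 ≤ q n ∧ q n < p n ∧ p n ≤ 1)
    (hI : ∀ᶠ n in atTop, 0 < renyiHalf (p n) (q n))
    (hℓ : Tendsto ℓ atTop atTop)
    (hA : Tendsto (fun n => ℓ n * renyiHalf (p n) (q n)) atTop atTop)
    (hlog : ∀ ε : ℝ, 0 < ε → ∀ᶠ n : ℕ in atTop,
      Real.log (n / ℓ n) ≤ ε * (ℓ n * renyiHalf (p n) (q n)))
    (hcfg : ∀ δ : ℝ, 0 < δ → ∀ᶠ n : ℕ in atTop, ∃ (f : Fin n → Fin (k n)) (a b : Fin (k n)),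
      a ≠ b ∧ (∀ d, ρ n * n / k n ≤ labelCount f d ∧ (labelCount f d : ℝ) ≤ ρ' n * n / k n) ∧
      ρ n * n / k n + 1 ≤ labelCount f a ∧ (labelCount f b : ℝ) + 1 ≤ ρ' n * n / k n ∧
      (ℓ n - 1 ≤ labelCount f a ∧ (labelCount f a : ℝ) ≤ (1 + δ) * ℓ n) ∧
      (ℓ n - 1 ≤ labelCount f b ∧ (labelCount f b : ℝ) ≤ (1 + δ) * ℓ n))
    {ε : ℝ} (hε : 0 < ε) :
    ∀ᶠ n : ℕ in atTop, n * Real.exp (-((1 + ε) * (ℓ n * renyiHalf (p n) (q n)))) ≤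
      minimaxRisk n (k n) (p n) (q n) (ρ n) (ρ' n) := by
  -- Four losses of δℓI: one from m ≤ (1+δ)ℓ, one from c = δℓI, one from n/ℓ, and one from the
  -- factor ℓ/(t+1) ≤ 10.
  obtain ⟨δ, hδ, hδ1, hδε⟩ : ∃ δ : ℝ, 0 < δ ∧ δ ≤ 1 ∧ 4 * δ ≤ ε :=
    ⟨min 1 (ε / 4), by positivity, min_le_left _ _, by linarith [min_le_right 1 (ε / 4)]⟩
  filter_upwards [hI, hcfg δ hδ, hlog δ hδ, hℓ.eventually_ge_atTop 8,
    hℓ.eventually_ge_atTop (64 / δ ^ 2), hA.eventually_ge_atTop (24 / δ ^ 2),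
    hA.eventually_ge_atTop (Real.log 10 / δ), eventually_gt_atTop 0] with
    n hI hcfg hlog h8 h64 h24 h10 hn
  obtain ⟨f, a, b, hab, hsize, ha, hb, ⟨ha1, ha2⟩, hb1, hb2⟩ := hcfg
  obtain ⟨hq0, hqp, hp1⟩ := hpq n
  have hn : (0 : ℝ) < n := by exact_mod_cast hn
  set I := renyiHalf (p n) (q n)
  set l := ℓ n
  have hl : 0 < l := by linarith
  set m := ⌊(1 + δ) * l⌋₊
  -- The largest t with 5t + 3 ≤ ℓ - 1.
  set t := ⌊(l - 4) / 5⌋₊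
  have hm : (m : ℝ) ≤ (1 + δ) * l := Nat.floor_le (by positivity)
  have ht : (t : ℝ) ≤ (l - 4) / 5 := Nat.floor_le (by linarith)
  have ht' : (l - 4) / 5 < t + 1 := Nat.lt_floor_add_one _
  have hca : labelCount f a ≤ m := Nat.le_floor ha2
  have hcb : labelCount f b ≤ m := Nat.le_floor hb2
  have hc : 0 < δ * (l * I) := by positivity
  have hmc : m * (6 * I + 16 * I ^ 2) ≤ (δ * (l * I)) ^ 2 := by
    have h1 : (m : ℝ) ≤ 2 * l := hm.trans (by nlinarith)
    have h2 : (m : ℝ) * (6 * I + 16 * I ^ 2) ≤ 2 * l * (6 * I + 16 * I ^ 2) :=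
      mul_le_mul_of_nonneg_right h1 (by positivity)
    rw [div_le_iff₀ (by positivity)] at h64 h24
    have h3 := mul_le_mul_of_nonneg_right h24 (show 0 ≤ l * I by positivity)
    have h4 := mul_le_mul_of_nonneg_right h64 (show 0 ≤ l * I ^ 2 by positivity)
    linarith
  have hmain := minimaxRisk_ge hq0 hqp hp1 (hellingerAffinity_pos_of_renyiHalf_pos hI) f hab
    (t := t) (m := m) hsize ha hb
    (by have : ((5 * t + 3 : ℕ) : ℝ) ≤ labelCount f a := by push_cast; linarith
        exact_mod_cast this)
    (by have : ((5 * t + 2 : ℕ) : ℝ) ≤ labelCount f b := by push_cast; linarith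
        exact_mod_cast this)
    (by omega) hcb hc hmc
  refine le_trans ?_ hmain
  have e1 : (n : ℝ) ≤ l * Real.exp (δ * (l * I)) := by
    have := (Real.log_le_iff_le_exp (by positivity)).1 hlog
    rwa [div_le_iff₀ hl, mul_comm] at this
  have e2 : (10 : ℝ) ≤ Real.exp (δ * (l * I)) := by
    rw [div_le_iff₀ hδ] at h10
    rw [← Real.log_le_iff_le_exp (by norm_num)]; linarith
  have e3 : (n : ℝ) ≤ (t + 1) * (Real.exp (δ * (l * I)) * Real.exp (δ * (l * I))) := by
    have h1 : l ≤ (t + 1) * Real.exp (δ * (l * I)) := by nlinarith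
    calc (n : ℝ) ≤ l * Real.exp (δ * (l * I)) := e1
      _ ≤ (t + 1) * Real.exp (δ * (l * I)) * Real.exp (δ * (l * I)) :=
          mul_le_mul_of_nonneg_right h1 (Real.exp_pos _).le
      _ = _ := by ring
  calc (n : ℝ) * Real.exp (-((1 + ε) * (l * I)))
      ≤ (t + 1) * (Real.exp (δ * (l * I)) * Real.exp (δ * (l * I))) *
        Real.exp (-((1 + ε) * (l * I))) :=
        mul_le_mul_of_nonneg_right e3 (Real.exp_pos _).le
    _ = (t + 1) * Real.exp (δ * (l * I) + δ * (l * I) + -((1 + ε) * (l * I))) := by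
        rw [Real.exp_add, Real.exp_add]; ring
    _ ≤ _ := by
        refine mul_le_mul_of_nonneg_left (Real.exp_le_exp.2 ?_) (by positivity)
        have h1 := mul_le_mul_of_nonneg_right hm hI.le
        have h2 := mul_le_mul_of_nonneg_right hδε (show 0 ≤ l * I by positivity)
        linarith

end SBM

/-! ### The two regimes -/

theorem theorem3p3
    (k : ℕ → ℕ) (p q ρ ρ' : ℕ → ℝ)
    (hpq : ∀ n, 0 ≤ q n ∧ q n < p n ∧ p n ≤ 1)
    (hroom : ∀ᶠ n : ℕ in atTop,
      ρ n * n / k n + 1 ≤ (n : ℝ) / k n ∧ (n : ℝ) / k n + 1 ≤ ρ' n * n / k n)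
    (hnI : Tendsto (fun n : ℕ => n * SBM.renyiHalf (p n) (q n) / (k n * Real.log (k n)))
      atTop atTop) :
    ((∀ᶠ n in atTop, 3 ≤ k n) →
      Tendsto (fun n : ℕ => ρ n * n / k n) atTop atTop →
      Tendsto (fun n : ℕ =>
        ρ n * n * SBM.renyiHalf (p n) (q n) / (k n * Real.log (k n / ρ n))) atTop atTop →
      (∀ ε : ℝ, 0 < ε → ∀ᶠ n : ℕ in atTop,
        ∃ Z ∈ SBM.Pi0Sized n (k n) (ρ n) (ρ' n), ∃ a b : Fin (k n), a ≠ b ∧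
          ((SBM.communitySize Z a : ℝ) + SBM.communitySize Z b) / 2
            ≤ (1 + ε) * (ρ n * n / k n)) →
      ∃ η : ℕ → ℝ, Tendsto η atTop (𝓝 0) ∧ ∀ᶠ n : ℕ in atTop,
        n * Real.exp (-((1 - η n) * (ρ n * n * SBM.renyiHalf (p n) (q n) / k n)))
          ≤ SBM.minimaxRisk n (k n) (p n) (q n) (ρ n) (ρ' n)) ∧
    ((∀ᶠ n in atTop, k n = 2) →
      ∃ η : ℕ → ℝ, Tendsto η atTop (𝓝 0) ∧ ∀ᶠ n : ℕ in atTop,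
        n * Real.exp (-((1 - η n) * (n * SBM.renyiHalf (p n) (q n) / 2)))
          ≤ SBM.minimaxRisk n (k n) (p n) (q n) (ρ n) (ρ' n)) := by
  have hI : ∀ᶠ n in atTop, 0 < SBM.renyiHalf (p n) (q n) := by
    filter_upwards [hnI.eventually_gt_atTop 0] with n hn
    by_contra! h
    refine absurd hn (not_lt.2 (div_nonpos_of_nonpos_of_nonneg ?_ ?_))
    · exact mul_nonpos_of_nonneg_of_nonpos (Nat.cast_nonneg n) h
    · exact mul_nonneg (Nat.cast_nonneg _) (Real.log_natCast_nonneg _)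
  refine ⟨fun hk hL hLI hatt => ?_, fun hk => ?_⟩
  · have hlog1 : ∀ᶠ n : ℕ in atTop, 0 < ρ n ∧ 1 ≤ Real.log (k n / ρ n) := by
      filter_upwards [hk, hL.eventually_gt_atTop 0, hroom] with n hk hL hroom
      have hk' : (3 : ℝ) ≤ k n := by exact_mod_cast hk
      have hkpos : (0 : ℝ) < k n := by linarith
      have hn0 : (0 : ℝ) < n := by
        refine lt_of_le_of_ne (Nat.cast_nonneg n) fun h => ?_
        rw [← h] at hL; simp at hL
      have hρ : 0 < ρ n := by
        by_contra! h
        refine absurd hL (not_lt.2 (div_nonpos_of_nonpos_of_nonneg ?_ hkpos.le))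
        exact mul_nonpos_of_nonpos_of_nonneg h hn0.le
      refine ⟨hρ, ?_⟩
      have hρ1 : ρ n ≤ 1 := by
        have h1 : ρ n * n / k n ≤ n / k n := by linarith [hroom.1]
        rw [div_le_div_iff_of_pos_right hkpos] at h1
        nlinarith
      -- Since ρ ≤ 1 and e < 3 ≤ k, the logarithm is at least 1, so dropping it from the hypothesis
      -- still gives ρnI/k → ∞.
      have h3 : (3 : ℝ) ≤ k n / ρ n := by rw [le_div_iff₀ hρ]; nlinarith
      rw [Real.le_log_iff_exp_le (by linarith)]
      linarith [Real.exp_one_lt_three]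
    have hA : Tendsto (fun n : ℕ => ρ n * n / k n * SBM.renyiHalf (p n) (q n)) atTop atTop := by
      refine tendsto_atTop_mono' _ ?_ hLI
      filter_upwards [hlog1, hI, hL.eventually_gt_atTop 0] with n hn hI hL
      rw [show ρ n * n * SBM.renyiHalf (p n) (q n) / (k n * Real.log (k n / ρ n)) =
        ρ n * n / k n * SBM.renyiHalf (p n) (q n) / Real.log (k n / ρ n) by
          rw [div_mul_eq_mul_div, div_div]]
      exact div_le_self (by positivity) hn.2
    have key := SBM.exists_tendsto_zero_of_forall_eps (hA.eventually_gt_atTop 0)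
      (fun ε hε => SBM.eventually_minimaxRisk_ge k p q ρ ρ' _ hpq hI hL hA ?_ ?_ hε)
    · simpa only [div_mul_eq_mul_div] using key
    · intro ε hε
      filter_upwards [hlog1, hLI.eventually_ge_atTop (1 / ε), hk, eventually_gt_atTop 0] with
        n hn h1 hk hn0
      have hk' : (k n : ℝ) ≠ 0 := by
        have : k n ≠ 0 := by omega
        exact_mod_cast this
      have hn0 : (n : ℝ) ≠ 0 := by exact_mod_cast hn0.ne'
      have hρ := hn.1.ne'
      have e : (n : ℝ) / (ρ n * n / k n) = k n / ρ n := by field_simp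
      rw [e]
      rw [show ρ n * n * SBM.renyiHalf (p n) (q n) / (k n * Real.log (k n / ρ n)) =
        ρ n * n / k n * SBM.renyiHalf (p n) (q n) / Real.log (k n / ρ n) by
          rw [div_mul_eq_mul_div, div_div], le_div_iff₀ (by linarith [hn.2]),
          div_mul_eq_mul_div, one_mul, div_le_iff₀ hε] at h1
      linarith
    · intro δ hδ
      filter_upwards [hatt (δ / 2) (by positivity), hroom,
        hL.eventually_ge_atTop (2 / δ)] with n ⟨Z, hZ, a, b, hab, hle⟩ hroom hL2
      obtain ⟨f, rfl⟩ := SBM.exists_labelMatrix_eq hZ.1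
      have hsize := hZ.2
      simp only [SBM.communitySize_labelMatrix] at hsize hle
      rw [div_le_iff₀ hδ] at hL2
      have ha := (hsize a).1
      have hb := (hsize b).1
      -- Both sizes are at least ρn/k and their mean is at most (1+δ/2)ρn/k, so each is at most
      -- (1+δ)ρn/k.
      obtain ⟨g, c, d, hcd, h1, h2, h3, h4, h5⟩ := SBM.exists_movable_config
        (M := (1 + δ) * (ρ n * n / k n)) hroom f hsize hab
        ⟨by unfold SBM.labelCount; linarith, by unfold SBM.labelCount; linarith⟩ (by linarith)
      exact ⟨g, c, d, hcd, h1, h2, h3, ⟨by linarith, h4⟩, by linarith [(h1 d).1], h5⟩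
  · have hL : Tendsto (fun n : ℕ => (n : ℝ) / 2) atTop atTop :=
      tendsto_natCast_atTop_atTop.atTop_div_const (by norm_num)
    have hlog2 : (1 : ℝ) / 2 ≤ Real.log 2 := by linarith [Real.log_two_gt_d9]
    have hA : Tendsto (fun n : ℕ => (n : ℝ) / 2 * SBM.renyiHalf (p n) (q n)) atTop atTop := by
      refine tendsto_atTop_mono' _ ?_ (hnI.atTop_div_const (show (0 : ℝ) < 2 by norm_num))
      filter_upwards [hk, hI] with n hk hI
      rw [hk]
      push_cast
      rw [div_div, div_le_iff₀ (by positivity)]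
      have : 0 ≤ (n : ℝ) * SBM.renyiHalf (p n) (q n) := by positivity
      nlinarith
    have key := SBM.exists_tendsto_zero_of_forall_eps (hA.eventually_gt_atTop 0)
      (fun ε hε => SBM.eventually_minimaxRisk_ge k p q ρ ρ' _ hpq hI hL hA ?_ ?_ hε)
    · simpa only [div_mul_eq_mul_div] using key
    · intro ε hε
      filter_upwards [hA.eventually_ge_atTop (Real.log 2 / ε), eventually_gt_atTop 0] with n h1 hn
      have hn : (n : ℝ) ≠ 0 := by exact_mod_cast hn.ne'
      rw [show (n : ℝ) / (n / 2) = 2 by field_simp]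
      rw [div_le_iff₀ hε] at h1
      linarith
    · intro δ hδ
      filter_upwards [hk, hroom, hL.eventually_ge_atTop (1 / δ)] with n hk hroom hn
      rw [div_le_iff₀ hδ] at hn
      rw [hk] at hroom ⊢
      -- Label 0 gets the larger half and is the donor; both sizes lie within 1/2 of n/2.
      obtain ⟨f, ha, hb⟩ := SBM.exists_balanced_labelling (n := n)
        (show (0 : Fin 2) ≠ 1 by decide)
      obtain ⟨r1, r2⟩ := hroom
      push_cast at r1 r2 ⊢
      have ha' : (SBM.labelCount f 0 : ℝ) = n - (n / 2 : ℕ) := by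
        rw [ha, Nat.cast_sub (Nat.div_le_self _ _)]
      have hb' : (SBM.labelCount f 1 : ℝ) = (n / 2 : ℕ) := by rw [hb]
      have hh1 : ((n / 2 : ℕ) : ℝ) ≤ n / 2 := Nat.cast_div_le
      have hh2 : (n : ℝ) ≤ 2 * (n / 2 : ℕ) + 1 := by
        have : n ≤ 2 * (n / 2) + 1 := by omega
        exact_mod_cast this
      refine ⟨f, 0, 1, by decide, ?_, ?_, ?_, ⟨?_, ?_⟩, ?_, ?_⟩
      · intro d
        fin_cases d
        · simp only [Fin.zero_eta, ha']; constructor <;> linarith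
        · simp only [Fin.mk_one, hb']; constructor <;> linarith
      all_goals first | rw [ha'] | rw [hb']
      all_goals linarith
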